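/- Consider the real massless right-moving scalar field in $1+1$ dimensions, with incoming field $$\phi(x)=\frac1{\sqrt{2\pi}}\int_0^\infty\frac{dk}{2k}\,\bigl[a(k)e^{-ikx}+a^\dagger(k)e^{ikx}\bigr],\qquad [a(k),a^\dagger(k')]=2k\,\delta(k-k'),$$ acting on the bosonic Fock space over $L^2(\mathbb R_+,\frac{dk}{2k})$ with vacuum $\Omega_o$, and the outgoing field $\hat\phi(y)=\phi(x(y))$, where the incoming and outgoing coordinates are related by $x(y)=-e^{-y}$ (relativistic black-hole model) or by $x(y)=-\log(1+e^{-y})$ (CGHS black-hole model), $y\in\mathbb R$. Let $g$ be a Schwartz function on $\mathbb R$ whose Fourier transform $\tilde g(k)=\frac1{\sqrt{2\pi}}\int e^{-ikx}g(x)\,dx$ vanishes for $k<0$ and which is normalized, $\int_0^\infty\frac{dk}{2k}|\tilde g(k)|^2=1$, and let $\Omega_g=\phi[g]^\dagger\Omega_o$ be the corresponding incoming one-particle state. Let $\hat T_g(y)$ be the regularized mean value in $\Omega_g$ of the outgoing energy-momentum observable $\hat\Theta(y)=\partial_y\hat\phi(y)^\dagger\,\partial_y\hat\phi(y)$, defined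 in either of the following two schemes. * Normal scheme: $\hat T_g(y)=(\Omega_g,:\!\hat\Theta(y)\!:_{out}\Omega_g)$, with normal ordering relative to the outgoing creation and annihilation operators; that is, $\hat T_g(y)$ is the value at $y'=y$ of the continuous kernel obtained from $(\Omega_g,\partial\hat\phi(y)^\dagger\,\partial\hat\phi(y')\,\Omega_g)$ by subtracting the mean value of $\partial\hat\phi(y)^\dagger\,\partial\hat\phi(y')$ in the outgoing vacuum (times $(\Omega_g,\Omega_g)=1$). * Subtraction scheme: $\hat T_g(y)=\lim_{\varepsilon\to0}\bigl[(\Omega_g,\hat\Theta_\varepsilon(y)\,\Omega_g)-(\Omega_o,\Theta_\varepsilon(x(y))\,\Omega_o)\bigr]$, where $\hat\Theta_\varepsilon(y)=\frac12[\partial\hat\phi(y)^\dagger\partial\hat\phi(y+\varepsilon)+\partial\hat\phi(y+\varepsilon)^\dagger\partial\hat\phi(y)]$ and $\Theta_\varepsilon(x)=\frac12[\partial\phi(x)^\dagger\partial\phi(x+\varepsilon)+\partial\phi(x+\varepsilon)^\dagger\partial\phi(x)]$, the mean values being understood as the continuous functions that represent the corresponding distributions off the diagonal. For $0<\beta\le\infty$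 let $T^{Th}_{\beta,out}=\frac{\pi}{12\beta^2}$ be the thermal value of the energy-momentum tensor at inverse temperature $\beta$ (so $T^{Th}_{\infty,out}=0$). Then, in each scheme and for both models, $\hat T_g(y)$ is well defined for every $y\in\mathbb R$ and $$\lim_{y\to+\infty}\hat T_g(y)=T^{Th}_{2\pi,out}=\frac{\pi}{12\,(2\pi)^2}.$$ Furthermore, for the CGHS model, $$\lim_{y\to-\infty}\hat T_g(y)=T^{Th}_{\infty,out}=0.$$ -/

import Mathlib

open MeasureTheory Filter Topology
open scoped SchwartzMap ContDiff ComplexConjugate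

noncomputable section

/-! ### The bosonic Fock space over `L²(ℝ₊, dk/2k)` in the momentum representation -/

/-- The measure `dk/2k` on the positive momenta. -/
def momentumMeasure : Measure ℝ :=
  (volume.restrict (Set.Ioi 0)).withDensity fun k => ENNReal.ofReal (1 / (2 * k))

/-- Fock vectors: `ψ n (k₁, …, kₙ)` is the `n`-particle wave function. Only vectors obtained from
the vacuum by finitely many applications of the field are used below; these have finitely many
nonzero components, each of them symmetric. -/
abbrev FockVector : Type := (n : ℕ) → (Fin n → ℝ) → ℂ

/-- The inner product `(ψ, χ) = ∑ₙ ∫ ∏ᵢ dkᵢ/2kᵢ ψₙ(k)^* χₙ(k)`. -/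
def fockInner (ψ χ : FockVector) : ℂ :=
  ∑' n, ∫ k, conj (ψ n k) * χ n k ∂(Measure.pi fun _ : Fin n => momentumMeasure)

/-- The vacuum `Ω_o`. -/
def fockVacuum : FockVector
  | 0 => fun _ => 1
  | _ + 1 => fun _ => 0

/-- The smeared annihilation operator `∫₀^∞ dk/2k u(k) a(k)`, where
`[a(k), a†(k')] = 2k δ(k - k')`. -/
def annihilate (u : ℝ → ℂ) (ψ : FockVector) : FockVector := fun n k =>
  (Real.sqrt (n + 1) : ℂ) * ∫ q, u q * ψ (n + 1) (Fin.cons q k) ∂momentumMeasure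

/-- The smeared creation operator `∫₀^∞ dk/2k v(k) a†(k)`. -/
def create (v : ℝ → ℂ) (ψ : FockVector) : FockVector
  | 0 => fun _ => 0
  | n + 1 => fun k =>
      ((Real.sqrt (n + 1) : ℝ) : ℂ)⁻¹ * ∑ i : Fin (n + 1), v (k i) * ψ n (fun j => k (i.succAbove j))

/-! ### The real massless (right moving) scalar field -/

/-- `(2π)^(-1/2) ∫ dy e^{-i k x(y)} f(y)`: for `x = id` this is the Fourier transform of `f`, and
for a change of coordinates `x = x(y)` it is the Fourier transform `U f̃` of the incoming test
function associated with the outgoing test function `f`. -/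
def incomingMomentum (x : ℝ → ℝ) (f : ℝ → ℂ) (k : ℝ) : ℂ :=
  ((Real.sqrt (2 * Real.pi) : ℝ) : ℂ)⁻¹ * ∫ y, Complex.exp (-Complex.I * k * x y) * f y

/-- The field smeared with `f`, in the coordinate `y` related to the incoming coordinate by
`x = x(y)`: this is `∫ dy f(y) φ(x(y))`, where
`φ(x) = (2π)^(-1/2) ∫₀^∞ dk/2k [a(k) e^{-ikx} + a†(k) e^{ikx}]`.
For `x = id` it is the incoming field `φ[f]`; otherwise it is the outgoing field `φ̂[f]`. -/
def field (x : ℝ → ℝ) (f : ℝ → ℂ) (ψ : FockVector) : FockVector :=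
  annihilate (fun k => incomingMomentum x f k) ψ + create (fun k => incomingMomentum x f (-k)) ψ

/-- The smeared derivative `∂_y φ(x(y))` of the field, in the sense of distributions. -/
def fieldDeriv (x : ℝ → ℝ) (f : ℝ → ℂ) (ψ : FockVector) : FockVector :=
  -field x (deriv f) ψ

/-- The one-particle state `Ω_g = φ[g]† Ω_o`; since the field is real, `φ[g]† = φ[g^*]`. -/
def oneParticle (g : ℝ → ℂ) : FockVector := field id (fun x => conj (g x)) fockVacuum

/-- The mean value in the state `ψ` of `∂φ ∂φ` (equal to `∂φ† ∂φ` as the field is real) smeared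
with `f₁` and `f₂`, in the coordinate `y` with `x = x(y)`. -/
def derivCorrelation (x : ℝ → ℝ) (ψ : FockVector) (f₁ f₂ : ℝ → ℂ) : ℂ :=
  fockInner ψ (fieldDeriv x f₁ (fieldDeriv x f₂ ψ))

/-- The product `∂φ̂[f₁] ∂φ̂[f₂]` of outgoing fields, normally ordered with respect to the outgoing
creation and annihilation operators: the product minus its mean value in the outgoing vacuum.
In the outgoing Fock space the outgoing field has the form `field id`. -/
def outNormalOrdered (x : ℝ → ℝ) (f₁ f₂ : ℝ → ℂ) (ψ : FockVector) : FockVector :=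
  fieldDeriv x f₁ (fieldDeriv x f₂ ψ) - derivCorrelation id fockVacuum f₁ f₂ • ψ

/-- The bilinear functional `B` of two test functions is given on the set `S` by the continuous
kernel `K`. -/
def IsKernelOn (B : (ℝ → ℂ) → (ℝ → ℂ) → ℂ) (S : Set (ℝ × ℝ)) (K : ℝ → ℝ → ℂ) : Prop :=
  ContinuousOn (fun p : ℝ × ℝ => K p.1 p.2) S ∧
  ∀ f₁ f₂ : ℝ → ℂ, ContDiff ℝ ∞ f₁ → HasCompactSupport f₁ →
    ContDiff ℝ ∞ f₂ → HasCompactSupport f₂ → tsupport f₁ ×ˢ tsupport f₂ ⊆ S →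
    B f₁ f₂ = ∫ p : ℝ × ℝ, K p.1 p.2 * f₁ p.1 * f₂ p.2

/-! ### The regularized energy-momentum tensor -/

/-- The mean value `½ [K(y, y+ε) + K(y+ε, y)]` of the point-split energy-momentum observable
`Θ_ε(y) = ½ [∂φ(y)† ∂φ(y+ε) + ∂φ(y+ε)† ∂φ(y)]`, where `K` is the kernel of the mean value of
`∂φ ∂φ`. -/
def pointSplit (K : ℝ → ℝ → ℂ) (y ε : ℝ) : ℂ := (K y (y + ε) + K (y + ε) y) / 2

/-- The two regularization schemes. -/
inductive RegularizationScheme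
  | normal
  | subtraction

/-- `t` is the regularized mean value `T̂_g(y)` of the outgoing energy-momentum observable in the
state `Ω_g`, for the change of coordinates `x = x(y)`.
Normal scheme: `(Ω_g, :∂φ̂(y)† ∂φ̂(y'):_out Ω_g)` is a continuous function, evaluated at `y' = y`.
Subtraction scheme: the limit, as `ε → 0`, of `(Ω_g, Θ̂_ε(y) Ω_g) - (Ω_o, Θ_ε(x(y)) Ω_o)`. -/
def IsOutgoingEMT (x : ℝ → ℝ) (g : ℝ → ℂ) (y t : ℝ) : RegularizationScheme → Prop
  | .normal => ∃ K : ℝ → ℝ → ℂ,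
      IsKernelOn (fun f₁ f₂ => fockInner (oneParticle g) (outNormalOrdered x f₁ f₂ (oneParticle g)))
        Set.univ K ∧
      K y y = t
  | .subtraction => ∃ K K₀ : ℝ → ℝ → ℂ,
      IsKernelOn (derivCorrelation x (oneParticle g)) {p | p.1 ≠ p.2} K ∧
      IsKernelOn (derivCorrelation id fockVacuum) {p | p.1 ≠ p.2} K₀ ∧
      Tendsto (fun ε => pointSplit K y ε - pointSplit K₀ (x y) ε) (𝓝[≠] 0) (𝓝 (t : ℂ))

/-- The thermal value `π / (12 β²)` of the energy-momentum tensor at inverse temperature `β`, with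
`β = ∞` allowed (zero temperature). -/
def thermalEMT (β : ENNReal) : ℝ := Real.pi / 12 * (β⁻¹).toReal ^ 2

theorem thermalEMT_ofReal (β : ℝ) (hβ : 0 < β) :
    thermalEMT (ENNReal.ofReal β) = Real.pi / (12 * β ^ 2) := by
  rw [thermalEMT, ENNReal.toReal_inv, ENNReal.toReal_ofReal hβ.le]
  field_simp

theorem thermalEMT_top : thermalEMT ⊤ = 0 := by simp [thermalEMT]

/-! ### The two black-hole models -/

/-- The relativistic black hole, in units with `M = 1` and with `Δ = 0`. -/
def relativisticCoord (y : ℝ) : ℝ := -Real.exp (-y)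

/-- The CGHS black hole, in units with `M = λ = 1` and with `x_o⁺ = 0`. -/
def cghsCoord (y : ℝ) : ℝ := -Real.log (1 + Real.exp (-y))

end

/-! ### Mean values in the vacuum and in one-particle states -/

/-! By Wick's theorem the correlation of `∂φ̂` in a normalized one-particle state is the vacuum
correlation plus a product term in the wave function (`fockInner_singleParticle_sub`). Fourier
inversion turns the product term into a smooth kernel whose diagonal value is `x'(y)² |g(x(y))|² /
2` (`particleCorrelation_eq`).

The vacuum correlation is formally `-(1/4π) x'(y) x'(z) / (x(y) - x(z))²`. Minus the outgoing vacuum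
correlation `-(1/4π) / (y - z)²`, it becomes `-(1/4π) ∂_y ∂_z log ((x(y) - x(z)) / (y - z))`, which
is continuous across the diagonal and equals `-(1/24π)` times the Schwarzian derivative of `x`
there. `vacuumCorrelation_sub_id` makes this rigorous: insert a cutoff `e^{-εk}`, move derivatives
onto the test functions until only logarithms remain, and let `ε → 0` in their difference.

Continuous kernels are unique (`IsKernelOn.unique`), so the normal scheme has exactly one value, the
sum of the two diagonal terms. The subtraction scheme gives the same value, because the incoming
vacuum kernel depends only on the separation `ε`. The limits are then elementary: at `+∞` the
Schwarzian tends to `-1/2`, which yields `1/(48π)`, while `x' → 0` kills the particle term; at `-∞`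
in the CGHS model `x' → 1`, the Schwarzian vanishes and `g` decays. -/

instance momentumMeasure_sigmaFinite : SigmaFinite momentumMeasure :=
  SigmaFinite.withDensity_ofReal _

/-- The Fock vector whose only component is the one-particle wave function `G`. -/
noncomputable def singleParticle (G : ℝ → ℂ) : FockVector
  | 1 => fun k => G (k 0)
  | _ => fun _ => 0

theorem singleParticle_of_ne_one (G : ℝ → ℂ) {n : ℕ} (hn : n ≠ 1) : singleParticle G n = 0 := by
  match n, hn with
  | 0, _ => rfl
  | n + 2, _ => rfl

theorem fockVacuum_of_ne_zero {n : ℕ} (hn : n ≠ 0) : fockVacuum n = 0 := by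
  match n, hn with
  | n + 1, _ => rfl

theorem fockInner_singleParticle (G : ℝ → ℂ) (χ : FockVector) :
    fockInner (singleParticle G) χ = ∫ q, conj (G q) * χ 1 (fun _ => q) ∂momentumMeasure := by
  unfold fockInner
  rw [tsum_eq_single 1 (fun n hn => by simp [singleParticle_of_ne_one G hn])]
  have h := (measurePreserving_funUnique momentumMeasure (Fin 1)).symm
  have h2 := h.integral_comp' (g := fun k : Fin 1 → ℝ => conj (singleParticle G 1 k) * χ 1 k)
  exact h2.symm

theorem fockInner_fockVacuum (χ : FockVector) :
    fockInner fockVacuum χ = χ 0 (fun i => i.elim0) := by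
  unfold fockInner
  rw [tsum_eq_single 0 (fun n hn => by simp [fockVacuum_of_ne_zero hn]), Measure.pi_of_empty _
    (fun i => i.elim0), integral_dirac]
  simp [fockVacuum]

theorem oneParticle_eq_singleParticle (g : ℝ → ℂ) :
    oneParticle g = singleParticle fun k => conj (incomingMomentum id g k) := by
  have hconj (k : ℝ) : incomingMomentum id (fun x => conj (g x)) (-k)
      = conj (incomingMomentum id g k) := by
    simp only [incomingMomentum, map_mul, map_inv₀, Complex.conj_ofReal, ← integral_conj,
      ← Complex.exp_conj]
    simp
  funext n
  match n with
  | 0 => funext k; simp [oneParticle, field, annihilate, create, fockVacuum, singleParticle]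
  | 1 =>
    funext k
    simp [oneParticle, field, annihilate, create, fockVacuum, singleParticle, ← hconj]
  | n + 2 =>
    funext k
    simp [oneParticle, field, annihilate, create, fockVacuum, singleParticle]

/-- The momentum modes of the smeared derivative of the field. -/
noncomputable def derivModes (x : ℝ → ℝ) (f : ℝ → ℂ) (k : ℝ) : ℂ := incomingMomentum x (deriv f) k

/-- The vacuum mean value of `∂φ[f₁] ∂φ[f₂]`. -/
noncomputable def vacuumCorrelation (x : ℝ → ℝ) (f₁ f₂ : ℝ → ℂ) : ℂ :=
  ∫ k, derivModes x f₁ k * derivModes x f₂ (-k) ∂momentumMeasure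

theorem derivCorrelation_fockVacuum (x : ℝ → ℝ) (f₁ f₂ : ℝ → ℂ) :
    derivCorrelation x fockVacuum f₁ f₂ = vacuumCorrelation x f₁ f₂ := by
  rw [derivCorrelation, fockInner_fockVacuum]
  simp [fieldDeriv, field, annihilate, create, fockVacuum, vacuumCorrelation, derivModes,
    integral_neg]

/-- There are three ways back to one particle: create with `f₂` and annihilate the created particle
(vacuum factor), create with `f₂` and annihilate the original one, or annihilate the original with
`f₂` and create with `f₁`. The square roots of the particle numbers cancel, as do the two signs in
`fieldDeriv`. -/
theorem fieldDeriv_fieldDeriv_singleParticle (x : ℝ → ℝ) (f₁ f₂ G : ℝ → ℂ)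
    (h₁₂ : Integrable (fun k => derivModes x f₁ k * derivModes x f₂ (-k)) momentumMeasure)
    (h₁ : Integrable (fun k => derivModes x f₁ k * G k) momentumMeasure) (q : ℝ) :
    fieldDeriv x f₁ (fieldDeriv x f₂ (singleParticle G)) 1 (fun _ => q) =
      vacuumCorrelation x f₁ f₂ * G q
        + derivModes x f₂ (-q) * ∫ k, derivModes x f₁ k * G k ∂momentumMeasure
        + derivModes x f₁ (-q) * ∫ k, derivModes x f₂ k * G k ∂momentumMeasure := by
  have e : ∀ k : ℝ, (fieldDeriv x f₂ (singleParticle G)) 2 (Fin.cons k fun _ => q) =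
      -(((Real.sqrt 2 : ℝ) : ℂ)⁻¹ * (derivModes x f₂ (-k) * G q + derivModes x f₂ (-q) * G k)) := by
    intro k
    simp [fieldDeriv, field, annihilate, create, singleParticle, derivModes, Fin.sum_univ_two,
      one_add_one_eq_two]
  have e0 : ∀ j, (fieldDeriv x f₂ (singleParticle G)) 0 j =
      -∫ k, derivModes x f₂ k * G k ∂momentumMeasure := by
    intro j
    simp [fieldDeriv, field, annihilate, create, singleParticle, derivModes]
  have e1 : fieldDeriv x f₁ (fieldDeriv x f₂ (singleParticle G)) 1 (fun _ => q) =
      -(((Real.sqrt 2 : ℝ) : ℂ) * ∫ k, derivModes x f₁ k *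
          (fieldDeriv x f₂ (singleParticle G)) 2 (Fin.cons k fun _ => q) ∂momentumMeasure)
        - derivModes x f₁ (-q) * (fieldDeriv x f₂ (singleParticle G)) 0 (fun i => i.elim0) := by
    -- Functions on `Fin 0` are equal, but not definitionally. Passing through `e0` replaces the
    -- argument by the one that `create` produces, so that the next identity is `rfl`.
    rw [e0, ← e0 (fun j => (fun _ => q : Fin 1 → ℝ) ((0 : Fin 1).succAbove j))]
    rw [show fieldDeriv x f₁ (fieldDeriv x f₂ (singleParticle G)) 1 (fun _ => q) =
      -(((Real.sqrt (((1 : ℕ) : ℝ) + 1) : ℝ) : ℂ) * ∫ k, derivModes x f₁ k *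
          (fieldDeriv x f₂ (singleParticle G)) 2 (Fin.cons k fun _ => q) ∂momentumMeasure +
        ((Real.sqrt (((0 : ℕ) : ℝ) + 1) : ℝ) : ℂ)⁻¹ * ∑ i : Fin 1, derivModes x f₁ (-q) *
          (fieldDeriv x f₂ (singleParticle G)) 0 (fun j => (fun _ => q : Fin 1 → ℝ) (i.succAbove j)))
      from rfl]
    simp [one_add_one_eq_two]
    ring
  rw [e1, e0]
  simp_rw [e]
  have e2 : ∀ k : ℝ, derivModes x f₁ k *
      -(((Real.sqrt 2 : ℝ) : ℂ)⁻¹ * (derivModes x f₂ (-k) * G q + derivModes x f₂ (-q) * G k))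
      = -((Real.sqrt 2 : ℝ) : ℂ)⁻¹ * ((derivModes x f₁ k * derivModes x f₂ (-k)) * G q
        + derivModes x f₂ (-q) * (derivModes x f₁ k * G k)) := by intro k; ring
  simp_rw [e2]
  rw [integral_const_mul, integral_add (h₁₂.mul_const _) (h₁.const_mul _), integral_mul_const,
    integral_const_mul, vacuumCorrelation]
  have h2 : ((Real.sqrt 2 : ℝ) : ℂ) ≠ 0 := by simp
  field_simp
  ring

/-- The mean value of `∂φ[f₁] ∂φ[f₂]` in a one-particle state, up to the vacuum contribution. -/
noncomputable def particleCorrelation (x : ℝ → ℝ) (G f₁ f₂ : ℝ → ℂ) : ℂ :=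
  (∫ k, derivModes x f₁ k * G k ∂momentumMeasure) *
      (∫ k, conj (G k) * derivModes x f₂ (-k) ∂momentumMeasure) +
    (∫ k, conj (G k) * derivModes x f₁ (-k) ∂momentumMeasure) *
      ∫ k, derivModes x f₂ k * G k ∂momentumMeasure

theorem integral_const_mul_add_three {α : Type*} [MeasurableSpace α] {μ : Measure α}
    {F₁ F₂ F₃ : α → ℂ} (h₁ : Integrable F₁ μ) (h₂ : Integrable F₂ μ) (h₃ : Integrable F₃ μ)
    (c₁ c₂ c₃ : ℂ) :
    ∫ a, c₁ * F₁ a + c₂ * F₂ a + c₃ * F₃ a ∂μ =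
      c₁ * ∫ a, F₁ a ∂μ + c₂ * ∫ a, F₂ a ∂μ + c₃ * ∫ a, F₃ a ∂μ := by
  have h₁₂ : Integrable (fun a => c₁ * F₁ a + c₂ * F₂ a) μ :=
    (h₁.const_mul c₁).add (h₂.const_mul c₂)
  rw [integral_add h₁₂ (h₃.const_mul c₃), integral_add (h₁.const_mul c₁) (h₂.const_mul c₂)]
  simp_rw [integral_const_mul]

theorem fockInner_singleParticle_sub (x : ℝ → ℝ) (f₁ f₂ G : ℝ → ℂ) (c : ℂ)
    (h₁₂ : Integrable (fun k => derivModes x f₁ k * derivModes x f₂ (-k)) momentumMeasure)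
    (h₁ : Integrable (fun k => derivModes x f₁ k * G k) momentumMeasure)
    (h₁' : Integrable (fun k => conj (G k) * derivModes x f₁ (-k)) momentumMeasure)
    (h₂' : Integrable (fun k => conj (G k) * derivModes x f₂ (-k)) momentumMeasure)
    (hG : Integrable (fun k => conj (G k) * G k) momentumMeasure)
    (hG1 : ∫ k, conj (G k) * G k ∂momentumMeasure = 1) :
    fockInner (singleParticle G)
        (fieldDeriv x f₁ (fieldDeriv x f₂ (singleParticle G)) - c • singleParticle G) =
      vacuumCorrelation x f₁ f₂ - c + particleCorrelation x G f₁ f₂ := by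
  rw [fockInner_singleParticle]
  have e (q : ℝ) : conj (G q) * (fieldDeriv x f₁ (fieldDeriv x f₂ (singleParticle G))
      - c • singleParticle G) 1 (fun _ => q) =
      (vacuumCorrelation x f₁ f₂ - c) * (conj (G q) * G q)
        + (∫ k, derivModes x f₁ k * G k ∂momentumMeasure) * (conj (G q) * derivModes x f₂ (-q))
        + (∫ k, derivModes x f₂ k * G k ∂momentumMeasure) * (conj (G q) * derivModes x f₁ (-q)) := by
    rw [Pi.sub_apply, Pi.sub_apply, fieldDeriv_fieldDeriv_singleParticle x f₁ f₂ G h₁₂ h₁]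
    simp [singleParticle]
    ring
  simp_rw [e]
  rw [integral_const_mul_add_three hG h₂' h₁', hG1, particleCorrelation]
  ring

/-! ### Decay of the momentum modes -/

/-- `x` is a strictly increasing change of coordinates of class `C³` with derivatives
`x₁`, `x₂`, `x₃`. -/
structure RegularCoord (x x₁ x₂ x₃ : ℝ → ℝ) : Prop where
  hasDerivAt : ∀ y, HasDerivAt x (x₁ y) y
  hasDerivAt_deriv : ∀ y, HasDerivAt x₁ (x₂ y) y
  hasDerivAt_deriv2 : ∀ y, HasDerivAt x₂ (x₃ y) y
  continuous_deriv3 : Continuous x₃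
  deriv_pos : ∀ y, 0 < x₁ y

namespace RegularCoord

variable {x x₁ x₂ x₃ : ℝ → ℝ}

theorem continuous (hx : RegularCoord x x₁ x₂ x₃) : Continuous x :=
  continuous_iff_continuousAt.2 fun y => (hx.hasDerivAt y).continuousAt

theorem continuous_deriv (hx : RegularCoord x x₁ x₂ x₃) : Continuous x₁ :=
  continuous_iff_continuousAt.2 fun y => (hx.hasDerivAt_deriv y).continuousAt

theorem continuous_deriv2 (hx : RegularCoord x x₁ x₂ x₃) : Continuous x₂ :=
  continuous_iff_continuousAt.2 fun y => (hx.hasDerivAt_deriv2 y).continuousAt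

end RegularCoord

theorem regularCoord_id : RegularCoord id (fun _ => 1) (fun _ => 0) fun _ => 0 where
  hasDerivAt := hasDerivAt_id
  hasDerivAt_deriv y := hasDerivAt_const y 1
  hasDerivAt_deriv2 y := hasDerivAt_const y 0
  continuous_deriv3 := continuous_const
  deriv_pos _ := one_pos

/-- Smooth functions with compact support. -/
structure IsTestFunction (f : ℝ → ℂ) : Prop where
  contDiff : ContDiff ℝ ∞ f
  hasCompactSupport : HasCompactSupport f

namespace IsTestFunction

variable {f : ℝ → ℂ}

theorem continuous (hf : IsTestFunction f) : Continuous f := hf.contDiff.continuous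

theorem hasDerivAt (hf : IsTestFunction f) (y : ℝ) : HasDerivAt f (deriv f y) y :=
  (hf.contDiff.differentiable (by simp)).differentiableAt.hasDerivAt

theorem deriv (hf : IsTestFunction f) : IsTestFunction (deriv f) where
  contDiff := (contDiff_infty_iff_deriv.1 hf.contDiff).2
  hasCompactSupport := hf.hasCompactSupport.deriv

theorem integrable (hf : IsTestFunction f) : Integrable f :=
  hf.continuous.integrable_of_hasCompactSupport hf.hasCompactSupport

theorem integrable_mul (hf : IsTestFunction f) {h : ℝ → ℂ} (hh : Continuous h) :
    Integrable fun y => h y * f y :=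
  (hh.mul hf.continuous).integrable_of_hasCompactSupport hf.hasCompactSupport.mul_left

end IsTestFunction

theorem norm_cexp_neg_I_mul (k s : ℝ) : ‖Complex.exp (-Complex.I * k * s)‖ = 1 := by
  rw [show -Complex.I * k * s = ((-(k * s) : ℝ) : ℂ) * Complex.I by push_cast; ring,
    Complex.norm_exp_ofReal_mul_I]

theorem norm_incomingMomentum_le (x : ℝ → ℝ) (f : ℝ → ℂ) (k : ℝ) :
    ‖incomingMomentum x f k‖ ≤ (Real.sqrt (2 * Real.pi))⁻¹ * ∫ y, ‖f y‖ := by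
  rw [incomingMomentum, norm_mul, norm_inv, Complex.norm_real, Real.norm_of_nonneg (by positivity)]
  gcongr
  refine (norm_integral_le_integral_norm _).trans_eq ?_
  simp only [norm_mul, norm_cexp_neg_I_mul, one_mul]

theorem continuous_incomingMomentum {x : ℝ → ℝ} (hx : Continuous x) {f : ℝ → ℂ}
    (hf : Integrable f) : Continuous (incomingMomentum x f) := by
  refine continuous_const.mul (continuous_of_dominated (bound := fun y => ‖f y‖) ?_ ?_ hf.norm ?_)
  · intro k
    exact AEStronglyMeasurable.mul (by fun_prop) hf.1
  · intro k
    filter_upwards with y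
    rw [norm_mul, norm_cexp_neg_I_mul, one_mul]
  · filter_upwards with y
    fun_prop

/-- Integration by parts against the phase `e^{-ikx(y)}`: each derivative is traded for a factor `k`
and a Jacobian `x₁`. -/
theorem incomingMomentum_deriv {x x₁ x₂ x₃ : ℝ → ℝ} (hx : RegularCoord x x₁ x₂ x₃) {h h' : ℝ → ℂ}
    (hh : ∀ y, HasDerivAt h (h' y) y) (hc : Continuous h') (hs : HasCompactSupport h) (k : ℝ) :
    incomingMomentum x h' k = Complex.I * k * incomingMomentum x (fun y => x₁ y * h y) k := by
  have hs' : HasCompactSupport h' := by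
    have : h' = deriv h := funext fun y => (hh y).deriv.symm
    exact this ▸ hs.deriv
  have hcx := hx.continuous
  have hcx1 := hx.continuous_deriv
  have hch : Continuous h := continuous_iff_continuousAt.2 fun y => (hh y).continuousAt
  have he : ∀ y, HasDerivAt (fun y : ℝ => Complex.exp (-Complex.I * k * x y))
      (Complex.exp (-Complex.I * k * x y) * (-Complex.I * k * x₁ y)) y := fun y =>
    ((hx.hasDerivAt y).ofReal_comp.const_mul _).cexp
  have key := integral_mul_deriv_eq_deriv_mul_of_integrable
    (u := fun y : ℝ => Complex.exp (-Complex.I * k * x y)) (v := h) (v' := h')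
    (fun y _ => he y) (fun y _ => hh y)
    (Continuous.integrable_of_hasCompactSupport (by fun_prop) hs'.mul_left)
    (Continuous.integrable_of_hasCompactSupport (by fun_prop) hs.mul_left)
    (Continuous.integrable_of_hasCompactSupport (by fun_prop) hs.mul_left)
  rw [incomingMomentum, incomingMomentum, key, mul_left_comm (Complex.I * k), ← integral_const_mul,
    ← integral_neg]
  congr 2
  funext y
  ring

theorem derivModes_eq {x x₁ x₂ x₃ : ℝ → ℝ} (hx : RegularCoord x x₁ x₂ x₃) {f : ℝ → ℂ}
    (hf : IsTestFunction f) (k : ℝ) :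
    derivModes x f k = Complex.I * k * incomingMomentum x (fun y => x₁ y * f y) k :=
  incomingMomentum_deriv hx hf.hasDerivAt hf.deriv.continuous hf.hasCompactSupport k

theorem continuous_derivModes {x : ℝ → ℝ} (hx : Continuous x) {f : ℝ → ℂ}
    (hf : IsTestFunction f) : Continuous (derivModes x f) :=
  continuous_incomingMomentum hx hf.deriv.integrable

/-- The factor `|k|` on the right cancels the infrared singularity of `dk/2k`; the `k²` on the left
gives decay at infinity. One integration by parts bounds the modes by `A |k|`. Writing `f' = x₁ ·
(f' / x₁)`, which needs `x₁ ≠ 0`, allows another one and bounds `|k|` times the modes by `B`. -/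
theorem exists_derivModes_bound {x x₁ x₂ x₃ : ℝ → ℝ} (hx : RegularCoord x x₁ x₂ x₃) {f : ℝ → ℂ}
    (hf : IsTestFunction f) : ∃ C, ∀ k, ‖derivModes x f k‖ * (1 + k ^ 2) ≤ C * |k| := by
  have hn (k : ℝ) (z : ℂ) : ‖Complex.I * k * z‖ = |k| * ‖z‖ := by simp
  have hcx1 := hx.continuous_deriv
  have hcx2 := hx.continuous_deriv2
  have h0 : ∀ y, (x₁ y : ℂ) ≠ 0 := fun y => by exact_mod_cast (hx.deriv_pos y).ne'
  have hd : ∀ y, HasDerivAt (fun y => deriv f y / x₁ y)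
      ((deriv (deriv f) y * x₁ y - deriv f y * x₂ y) / (x₁ y : ℂ) ^ 2) y := fun y =>
    (hf.deriv.hasDerivAt y).div (hx.hasDerivAt_deriv y).ofReal_comp (h0 y)
  have c1 := hf.deriv.continuous
  have c2 := hf.deriv.deriv.continuous
  have h2 (k : ℝ) := incomingMomentum_deriv hx hd
    (Continuous.div (by fun_prop) (by fun_prop) fun y => pow_ne_zero 2 (h0 y))
    (hf.deriv.hasCompactSupport.mono fun y hy => by
      simp only [Function.mem_support] at hy ⊢; intro h; simp [h] at hy) k
  have e : (fun y => (x₁ y : ℂ) * (deriv f y / x₁ y)) = deriv f :=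
    funext fun y => mul_div_cancel₀ _ (h0 y)
  rw [e] at h2
  obtain ⟨A, hA⟩ : ∃ A, ∀ k, ‖derivModes x f k‖ ≤ |k| * A := ⟨_, fun k => by
    rw [derivModes_eq hx hf, hn]
    exact mul_le_mul_of_nonneg_left (norm_incomingMomentum_le x _ k) (abs_nonneg k)⟩
  obtain ⟨B, hB⟩ : ∃ B, ∀ k, |k| * ‖derivModes x f k‖ ≤ B := ⟨_, fun k => by
    rw [derivModes, ← hn, ← h2]
    exact norm_incomingMomentum_le x _ k⟩
  refine ⟨A + B, fun k => ?_⟩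
  calc ‖derivModes x f k‖ * (1 + k ^ 2)
      = ‖derivModes x f k‖ + (|k| * ‖derivModes x f k‖) * |k| := by rw [← sq_abs k]; ring
    _ ≤ |k| * A + B * |k| := add_le_add (hA k) (mul_le_mul_of_nonneg_right (hB k) (abs_nonneg k))
    _ = (A + B) * |k| := by ring

/-! ### Integration against `dk/2k`. -/

theorem integral_momentumMeasure (F : ℝ → ℂ) :
    ∫ k, F k ∂momentumMeasure = ∫ k in Set.Ioi (0 : ℝ), (1 / (2 * k) : ℂ) * F k := by
  rw [momentumMeasure, integral_withDensity_eq_integral_toReal_smul (by fun_prop) (by simp)]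
  refine setIntegral_congr_fun measurableSet_Ioi fun k hk => ?_
  have hk : 0 < k := hk
  rw [ENNReal.toReal_ofReal (by positivity), Complex.real_smul]
  push_cast
  rfl

theorem integrable_momentumMeasure {F : ℝ → ℂ} (hF : Continuous F) {C : ℝ}
    (hC : ∀ k, 0 < k → ‖F k‖ * (1 + k ^ 2) ≤ C * k) : Integrable F momentumMeasure := by
  have hm : Measurable fun k : ℝ => (ENNReal.ofReal (1 / (2 * k))).toReal := by fun_prop
  rw [momentumMeasure, integrable_withDensity_iff_integrable_smul' (by fun_prop) (by simp)]
  refine (((integrable_inv_one_add_sq).const_mul (C / 2)).integrableOn).mono'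
    (hm.aestronglyMeasurable.smul hF.aestronglyMeasurable) ?_
  filter_upwards [ae_restrict_mem measurableSet_Ioi] with k hk
  have hk : 0 < k := hk
  rw [ENNReal.toReal_ofReal (by positivity), norm_smul, Real.norm_of_nonneg (by positivity)]
  have h := hC k hk
  have h1 : 0 < 1 + k ^ 2 := by positivity
  rw [← le_div_iff₀ h1] at h
  calc 1 / (2 * k) * ‖F k‖ ≤ 1 / (2 * k) * (C * k / (1 + k ^ 2)) := by gcongr
    _ = C / 2 * (1 + k ^ 2)⁻¹ := by field_simp

theorem integrable_mul_momentumMeasure {F H : ℝ → ℂ} (hF : Continuous F) (hH : Continuous H)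
    {C M : ℝ} (hC : ∀ k, 0 < k → ‖F k‖ * (1 + k ^ 2) ≤ C * |k|) (hM : ∀ k, 0 < k → ‖H k‖ ≤ M) :
    Integrable (fun k => F k * H k) momentumMeasure := by
  refine integrable_momentumMeasure (hF.mul hH) (C := C * M) fun k hk => ?_
  calc ‖F k * H k‖ * (1 + k ^ 2) = (‖F k‖ * (1 + k ^ 2)) * ‖H k‖ := by rw [norm_mul]; ring
    _ ≤ (C * |k|) * M := mul_le_mul (hC k hk) (hM k hk) (norm_nonneg _)
        ((by positivity : (0 : ℝ) ≤ ‖F k‖ * (1 + k ^ 2)).trans (hC k hk))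
    _ = C * M * k := by rw [abs_of_pos hk]; ring

theorem integrable_derivModes_mul {x x₁ x₂ x₃ : ℝ → ℝ} (hx : RegularCoord x x₁ x₂ x₃) {f : ℝ → ℂ}
    (hf : IsTestFunction f) {H : ℝ → ℂ} (hH : Continuous H) {M : ℝ} (hM : ∀ k, ‖H k‖ ≤ M) :
    Integrable (fun k => derivModes x f k * H k) momentumMeasure := by
  obtain ⟨C, hC⟩ := exists_derivModes_bound hx hf
  exact integrable_mul_momentumMeasure (continuous_derivModes hx.continuous hf) hH
    (fun k _ => hC k) fun k _ => hM k

theorem integrable_mul_derivModes_neg {x x₁ x₂ x₃ : ℝ → ℝ} (hx : RegularCoord x x₁ x₂ x₃)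
    {f : ℝ → ℂ} (hf : IsTestFunction f) {H : ℝ → ℂ} (hH : Continuous H) {M : ℝ}
    (hM : ∀ k, ‖H k‖ ≤ M) :
    Integrable (fun k => H k * derivModes x f (-k)) momentumMeasure := by
  obtain ⟨C, hC⟩ := exists_derivModes_bound hx hf
  simp_rw [mul_comm (H _)]
  exact integrable_mul_momentumMeasure
    ((continuous_derivModes hx.continuous hf).comp continuous_neg) hH
    (fun k _ => by simpa using hC (-k)) fun k _ => hM k

theorem integrable_derivModes_mul_derivModes_neg {x x₁ x₂ x₃ : ℝ → ℝ}
    (hx : RegularCoord x x₁ x₂ x₃) {f₁ f₂ : ℝ → ℂ} (hf₁ : IsTestFunction f₁)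
    (hf₂ : IsTestFunction f₂) :
    Integrable (fun k => derivModes x f₁ k * derivModes x f₂ (-k)) momentumMeasure :=
  integrable_derivModes_mul hx hf₁ ((continuous_derivModes hx.continuous hf₂).comp continuous_neg)
    fun _ => norm_incomingMomentum_le _ _ _

/-! ### The regularized vacuum correlation -/

theorem integrableOn_mul_exp_neg_mul {a : ℝ} (ha : 0 < a) :
    IntegrableOn (fun k : ℝ => k * Real.exp (-a * k)) (Set.Ioi 0) := by
  have := integrableOn_rpow_mul_exp_neg_mul_rpow (p := 1) (s := 1) (b := a) (by norm_num)
    one_pos ha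
  simpa using this

theorem norm_mul_cexp_neg_mul (a : ℂ) {k : ℝ} (hk : 0 ≤ k) :
    ‖(k : ℂ) * Complex.exp (-a * k)‖ = k * Real.exp (-a.re * k) := by
  rw [norm_mul, Complex.norm_exp, Complex.norm_real, Real.norm_of_nonneg hk]
  simp

theorem integrableOn_mul_cexp_neg_mul {a : ℂ} (ha : 0 < a.re) :
    IntegrableOn (fun k : ℝ => (k : ℂ) * Complex.exp (-a * k)) (Set.Ioi 0) := by
  refine (integrableOn_mul_exp_neg_mul ha).mono' (by fun_prop) ?_
  filter_upwards [ae_restrict_mem measurableSet_Ioi] with k hk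
  exact (norm_mul_cexp_neg_mul a (le_of_lt hk)).le

theorem integral_mul_cexp_neg_mul {a : ℂ} (ha : 0 < a.re) :
    ∫ k in Set.Ioi (0 : ℝ), (k : ℂ) * Complex.exp (-a * k) = 1 / a ^ 2 := by
  have h0 : a ≠ 0 := by rintro rfl; simp at ha
  have hd : ∀ k ∈ Set.Ici (0 : ℝ), HasDerivAt
      (fun k : ℝ => -((k : ℂ) / a + 1 / a ^ 2) * Complex.exp (-a * k))
      ((k : ℂ) * Complex.exp (-a * k)) k := by
    intro k _
    have h1 : HasDerivAt (fun k : ℝ => (k : ℂ)) 1 k := Complex.ofRealCLM.hasDerivAt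
    refine ((((h1.div_const a).add_const (1 / a ^ 2)).fun_neg).fun_mul
      ((h1.const_mul (-a)).cexp)).congr_deriv ?_
    field_simp
    ring
  have ht : Tendsto (fun k : ℝ => -((k : ℂ) / a + 1 / a ^ 2) * Complex.exp (-a * k)) atTop
      (𝓝 0) := by
    have t1 : Tendsto (fun k : ℝ => (k : ℂ) * Complex.exp (-a * k)) atTop (𝓝 0) := by
      rw [tendsto_zero_iff_norm_tendsto_zero]
      refine (tendsto_rpow_mul_exp_neg_mul_atTop_nhds_zero 1 a.re ha).congr' ?_
      filter_upwards [eventually_ge_atTop 0] with k hk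
      rw [norm_mul_cexp_neg_mul a hk, Real.rpow_one]
    have t2 : Tendsto (fun k : ℝ => Complex.exp (-a * k)) atTop (𝓝 0) := by
      rw [tendsto_zero_iff_norm_tendsto_zero]
      refine (tendsto_rpow_mul_exp_neg_mul_atTop_nhds_zero 0 a.re ha).congr' ?_
      filter_upwards with k
      simp [Complex.norm_exp]
    have := (t1.const_mul (-(1 / a))).sub (t2.const_mul (1 / a ^ 2))
    simp only [mul_zero, sub_zero] at this
    refine this.congr fun k => ?_
    field_simp
    ring
  rw [integral_Ioi_of_hasDerivAt_of_tendsto' hd (integrableOn_mul_cexp_neg_mul ha) ht]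
  simp

/-- The product of modes is already integrable and dominates its damped versions. The cutoff is
there for the position representation: without it the momentum integral of `k e^{-iks}` diverges. -/
theorem tendsto_vacuumCorrelation {x x₁ x₂ x₃ : ℝ → ℝ} (hx : RegularCoord x x₁ x₂ x₃)
    {f₁ f₂ : ℝ → ℂ} (hf₁ : IsTestFunction f₁) (hf₂ : IsTestFunction f₂) :
    Tendsto (fun ε : ℝ => ∫ k : ℝ, Complex.exp (-ε * k) *
      (derivModes x f₁ k * derivModes x f₂ (-k)) ∂momentumMeasure) (𝓝[>] 0)
      (𝓝 (vacuumCorrelation x f₁ f₂)) := by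
  have hi := integrable_derivModes_mul_derivModes_neg hx hf₁ hf₂
  refine tendsto_integral_filter_of_dominated_convergence _ (.of_forall fun ε => ?_) ?_ hi.norm ?_
  · exact AEStronglyMeasurable.mul (by fun_prop) hi.1
  · filter_upwards [self_mem_nhdsWithin] with ε hε
    have hε : 0 < ε := hε
    have hpos : ∀ᵐ k ∂momentumMeasure, k ∈ Set.Ioi (0 : ℝ) :=
      (withDensity_absolutelyContinuous _ _).ae_le (ae_restrict_mem measurableSet_Ioi)
    filter_upwards [hpos] with k hk
    have hk : 0 < k := hk
    rw [norm_mul, Complex.norm_exp]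
    refine mul_le_of_le_one_left (norm_nonneg _) (Real.exp_le_one_iff.2 ?_)
    simp only [Complex.mul_re, Complex.neg_re, Complex.ofReal_re, Complex.neg_im, Complex.ofReal_im]
    nlinarith [mul_pos hε hk]
  · filter_upwards with k
    have : Tendsto (fun ε : ℝ => Complex.exp (-ε * k) *
        (derivModes x f₁ k * derivModes x f₂ (-k))) (𝓝 0)
        (𝓝 (Complex.exp (-(0 : ℝ) * k) * (derivModes x f₁ k * derivModes x f₂ (-k)))) :=
      Continuous.tendsto (by fun_prop) 0
    simp only [Complex.ofReal_zero, neg_zero, zero_mul, Complex.exp_zero, one_mul] at this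
    exact this.mono_left nhdsWithin_le_nhds

/-- Each smeared derivative contributes a factor `k`, so `k² · dk/2k` leaves `k/2`, and the two
Fourier normalizations turn `1/2` into `1/(4π)`. After Fubini the momentum integral is `∫ k e^{-ak}
dk = 1/a²` with `a = ε + i(x(y) - x(z))`. -/
theorem integral_exp_mul_derivModes {x x₁ x₂ x₃ : ℝ → ℝ} (hx : RegularCoord x x₁ x₂ x₃)
    {f₁ f₂ : ℝ → ℂ} (hf₁ : IsTestFunction f₁) (hf₂ : IsTestFunction f₂) {ε : ℝ} (hε : 0 < ε) :
    ∫ k : ℝ, Complex.exp (-ε * k) * (derivModes x f₁ k * derivModes x f₂ (-k)) ∂momentumMeasure =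
      1 / (4 * Real.pi) * ∫ p : ℝ × ℝ, (x₁ p.1 * x₁ p.2 : ℂ) /
        (ε + Complex.I * (x p.1 - x p.2)) ^ 2 * (f₁ p.1 * f₂ p.2) := by
  have hcx := hx.continuous
  have hcx1 := hx.continuous_deriv
  have hi₁ : Integrable fun y => (x₁ y : ℂ) * f₁ y := hf₁.integrable_mul (by fun_prop)
  have hi₂ : Integrable fun y => (x₁ y : ℂ) * f₂ y := hf₂.integrable_mul (by fun_prop)
  set F : ℝ → ℝ × ℝ → ℂ := fun k p => (k : ℂ) *
    Complex.exp (-(ε + Complex.I * (x p.1 - x p.2)) * k) *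
      ((x₁ p.1 * f₁ p.1) * (x₁ p.2 * f₂ p.2)) with hF
  have hFi : Integrable (Function.uncurry F)
      ((volume.restrict (Set.Ioi (0 : ℝ))).prod (volume : Measure (ℝ × ℝ))) := by
    -- Up to a unimodular phase, `F` is a product of integrable functions of the separate variables.
    have h1 := (integrableOn_mul_cexp_neg_mul (a := ε) (by simpa using hε)).mul_prod
      (hi₁.mul_prod hi₂)
    refine h1.bdd_mul (c := 1)
      (f := fun q : ℝ × ℝ × ℝ => Complex.exp (-Complex.I * q.1 * (x q.2.1 - x q.2.2 : ℝ)))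
      (by fun_prop) (by filter_upwards with q; rw [norm_cexp_neg_I_mul]) |>.congr ?_
    filter_upwards with q
    simp only [Function.uncurry, hF]
    rw [show -(ε + Complex.I * (x q.2.1 - x q.2.2)) * (q.1 : ℂ) = -Complex.I * q.1 *
      ((x q.2.1 - x q.2.2 : ℝ) : ℂ) + -ε * q.1 by push_cast; ring, Complex.exp_add]
    ring
  have hs2 : (((Real.sqrt (2 * Real.pi) : ℝ) : ℂ))⁻¹ ^ 2 = (2 * (Real.pi : ℂ))⁻¹ := by
    rw [inv_pow, ← Complex.ofReal_pow, Real.sq_sqrt (by positivity)]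
    push_cast; rfl
  calc _ = ∫ k in Set.Ioi (0 : ℝ), 1 / (4 * Real.pi) * ∫ p, F k p := by
        rw [integral_momentumMeasure]
        refine setIntegral_congr_fun measurableSet_Ioi fun k hk => ?_
        have hk0 : (k : ℂ) ≠ 0 := by exact_mod_cast (ne_of_gt hk)
        rw [derivModes_eq hx hf₁, derivModes_eq hx hf₂, incomingMomentum, incomingMomentum]
        have e : ∫ p, F k p = (k * Complex.exp (-ε * k)) *
            ((∫ y, Complex.exp (-Complex.I * k * x y) * (x₁ y * f₁ y)) *
            ∫ y, Complex.exp (-Complex.I * (-k : ℝ) * x y) * (x₁ y * f₂ y)) := by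
          rw [← integral_prod_mul, ← integral_const_mul]
          refine integral_congr_ae (.of_forall fun p => ?_)
          simp only [hF]
          rw [show -(ε + Complex.I * (x p.1 - x p.2)) * (k : ℂ) = -ε * k +
            (-Complex.I * k * x p.1 + -Complex.I * (-k : ℝ) * x p.2) by push_cast; ring,
            Complex.exp_add, Complex.exp_add]
          ring
        rw [e]
        generalize (∫ y, Complex.exp (-Complex.I * k * x y) * (x₁ y * f₁ y)) = A
        generalize (∫ y, Complex.exp (-Complex.I * (-k : ℝ) * x y) * (x₁ y * f₂ y)) = B
        have hpi : (Real.pi : ℂ) ≠ 0 := by exact_mod_cast Real.pi_ne_zero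
        push_cast
        calc _ = -Complex.I ^ 2 * (((Real.sqrt (2 * Real.pi) : ℝ) : ℂ))⁻¹ ^ 2 *
              (k ^ 2 / (2 * k)) * Complex.exp (-ε * k) * A * B := by ring
          _ = _ := by
            rw [hs2, Complex.I_sq]
            field_simp
            ring
    _ = 1 / (4 * Real.pi) * ∫ p, ∫ k in Set.Ioi (0 : ℝ), F k p := by
        rw [integral_const_mul, integral_integral_swap hFi]
    _ = _ := by
        congr 1
        refine integral_congr_ae (.of_forall fun p => ?_)
        simp only [hF]
        rw [integral_mul_const, integral_mul_cexp_neg_mul (by simpa using hε)]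
        ring

/-! ### Integration by parts in two variables -/

theorem IsTestFunction.tsupport_prod_subset {f₁ f₂ : ℝ → ℂ} :
    tsupport (fun p : ℝ × ℝ => f₁ p.1 * f₂ p.2) ⊆ tsupport f₁ ×ˢ tsupport f₂ := by
  refine closure_minimal (fun p hp => ?_) ((isClosed_tsupport _).prod (isClosed_tsupport _))
  rw [Function.mem_support] at hp
  exact ⟨subset_tsupport _ (left_ne_zero_of_mul hp), subset_tsupport _ (right_ne_zero_of_mul hp)⟩

theorem IsTestFunction.hasCompactSupport_prod {f₁ f₂ : ℝ → ℂ} (hf₁ : IsTestFunction f₁)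
    (hf₂ : IsTestFunction f₂) : HasCompactSupport fun p : ℝ × ℝ => f₁ p.1 * f₂ p.2 :=
  (hf₁.hasCompactSupport.isCompact.prod hf₂.hasCompactSupport.isCompact).of_isClosed_subset
    (isClosed_tsupport _) tsupport_prod_subset

theorem IsTestFunction.continuous_prod {f₁ f₂ : ℝ → ℂ} (hf₁ : IsTestFunction f₁)
    (hf₂ : IsTestFunction f₂) : Continuous fun p : ℝ × ℝ => f₁ p.1 * f₂ p.2 := by
  have := hf₁.continuous
  have := hf₂.continuous
  fun_prop

theorem IsTestFunction.continuous_mul_prod {f₁ f₂ : ℝ → ℂ} (hf₁ : IsTestFunction f₁)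
    (hf₂ : IsTestFunction f₂) {K : ℝ × ℝ → ℂ} {S : Set (ℝ × ℝ)} (hS : IsOpen S)
    (hK : ContinuousOn K S) (hs : tsupport f₁ ×ˢ tsupport f₂ ⊆ S) :
    Continuous fun p : ℝ × ℝ => K p * (f₁ p.1 * f₂ p.2) :=
  (hK.mul (hf₁.continuous_prod hf₂).continuousOn).continuous_of_tsupport_subset hS
    (((closure_mono (Function.support_mul_subset_right _ _)).trans tsupport_prod_subset).trans hs)

theorem IsTestFunction.integrable_mul_prod_of_continuousOn {f₁ f₂ : ℝ → ℂ}
    (hf₁ : IsTestFunction f₁) (hf₂ : IsTestFunction f₂) {K : ℝ × ℝ → ℂ} {S : Set (ℝ × ℝ)}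
    (hS : IsOpen S) (hK : ContinuousOn K S) (hs : tsupport f₁ ×ˢ tsupport f₂ ⊆ S) :
    Integrable fun p : ℝ × ℝ => K p * (f₁ p.1 * f₂ p.2) :=
  (hf₁.continuous_mul_prod hf₂ hS hK hs).integrable_of_hasCompactSupport
    (hf₁.hasCompactSupport_prod hf₂).mul_left

theorem IsTestFunction.integrable_mul_prod {f₁ f₂ : ℝ → ℂ}
    (hf₁ : IsTestFunction f₁) (hf₂ : IsTestFunction f₂) {K : ℝ × ℝ → ℂ} (hK : Continuous K) :
    Integrable fun p : ℝ × ℝ => K p * (f₁ p.1 * f₂ p.2) :=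
  hf₁.integrable_mul_prod_of_continuousOn hf₂ isOpen_univ hK.continuousOn (Set.subset_univ _)

theorem integral_deriv_mul_testFunction {A A' : ℝ → ℂ} (hA : ∀ y, HasDerivAt A (A' y) y)
    (hA' : Continuous A') {f : ℝ → ℂ} (hf : IsTestFunction f) :
    ∫ y, A' y * f y = -∫ y, A y * deriv f y := by
  have hAc : Continuous A := continuous_iff_continuousAt.2 fun y => (hA y).continuousAt
  have h := integral_mul_deriv_eq_deriv_mul_of_integrable (u := A) (u' := A')
    (fun y _ => hA y) (fun y _ => hf.hasDerivAt y)
    (hf.deriv.integrable_mul hAc) (hf.integrable_mul hA') (hf.integrable_mul hAc)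
  rw [h, neg_neg]

theorem integral_mixed_deriv_mul_testFunction {A A₁ A₁₂ : ℝ → ℝ → ℂ}
    (h₁ : ∀ y z, HasDerivAt (fun y => A y z) (A₁ y z) y)
    (h₁₂ : ∀ y z, HasDerivAt (A₁ y) (A₁₂ y z) z)
    (hA : Continuous fun p : ℝ × ℝ => A p.1 p.2) (hA₁ : Continuous fun p : ℝ × ℝ => A₁ p.1 p.2)
    (hA₁₂ : Continuous fun p : ℝ × ℝ => A₁₂ p.1 p.2)
    {f₁ f₂ : ℝ → ℂ} (hf₁ : IsTestFunction f₁) (hf₂ : IsTestFunction f₂) :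
    ∫ p : ℝ × ℝ, A₁₂ p.1 p.2 * (f₁ p.1 * f₂ p.2) =
      ∫ p : ℝ × ℝ, A p.1 p.2 * (deriv f₁ p.1 * deriv f₂ p.2) := by
  have s₁ : ∫ p : ℝ × ℝ, A₁₂ p.1 p.2 * (f₁ p.1 * f₂ p.2) =
      -∫ p : ℝ × ℝ, A₁ p.1 p.2 * (f₁ p.1 * deriv f₂ p.2) := by
    rw [Measure.volume_eq_prod, integral_prod _ (hf₁.integrable_mul_prod hf₂ hA₁₂),
      integral_prod _ (hf₁.integrable_mul_prod hf₂.deriv hA₁), ← integral_neg]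
    congr 1
    funext y
    simp_rw [mul_left_comm _ (f₁ y)]
    rw [integral_const_mul, integral_const_mul,
      integral_deriv_mul_testFunction (h₁₂ y) (by fun_prop) hf₂, mul_neg]
  have s₂ : ∫ p : ℝ × ℝ, A₁ p.1 p.2 * (f₁ p.1 * deriv f₂ p.2) =
      -∫ p : ℝ × ℝ, A p.1 p.2 * (deriv f₁ p.1 * deriv f₂ p.2) := by
    rw [Measure.volume_eq_prod, integral_prod_symm _ (hf₁.integrable_mul_prod hf₂.deriv hA₁),
      integral_prod_symm _ (hf₁.deriv.integrable_mul_prod hf₂.deriv hA), ← integral_neg]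
    congr 1
    funext z
    simp_rw [← mul_assoc]
    rw [integral_mul_const, integral_mul_const,
      integral_deriv_mul_testFunction (fun y => h₁ y z) (by fun_prop) hf₁, neg_mul]
  rw [s₁, s₂, neg_neg]

/-! ### Averages over the segment between two points -/

/-- The weighted average of `φ` over the segment from `z` to `y`. -/
noncomputable def segmentAverage (w φ : ℝ → ℝ) (y z : ℝ) : ℝ :=
  ∫ t in (0 : ℝ)..1, w t * φ (z + t * (y - z))

theorem continuous_segmentAverage {w φ : ℝ → ℝ} (hw : Continuous w) (hφ : Continuous φ) :
    Continuous fun p : ℝ × ℝ => segmentAverage w φ p.1 p.2 :=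
  intervalIntegral.continuous_parametric_intervalIntegral_of_continuous'
    (f := fun (p : ℝ × ℝ) t => w t * φ (p.2 + t * (p.1 - p.2))) (by fun_prop) 0 1

theorem hasDerivAt_integral_mul_comp_affine {w a b φ φ' : ℝ → ℝ} (hw : Continuous w)
    (ha : Continuous a) (hb : Continuous b) (hφ : ∀ y, HasDerivAt φ (φ' y) y)
    (hφ' : Continuous φ') (s : ℝ) :
    HasDerivAt (fun s => ∫ t in (0 : ℝ)..1, w t * φ (a t + b t * s))
      (∫ t in (0 : ℝ)..1, w t * b t * φ' (a t + b t * s)) s := by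
  have hφc : Continuous φ := continuous_iff_continuousAt.2 fun y => (hφ y).continuousAt
  obtain ⟨C, hC⟩ := ((isCompact_closedBall s 1).prod
    (isCompact_Icc (a := (0 : ℝ)) (b := 1))).exists_bound_of_continuousOn
    (f := fun p : ℝ × ℝ => w p.2 * b p.2 * φ' (a p.2 + b p.2 * p.1)) (by fun_prop)
  refine (intervalIntegral.hasDerivAt_integral_of_dominated_loc_of_deriv_le
    (bound := fun _ => C) (F' := fun s t => w t * b t * φ' (a t + b t * s))
    (Metric.closedBall_mem_nhds s one_pos)
    (.of_forall fun s => Continuous.aestronglyMeasurable (by fun_prop))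
    (Continuous.intervalIntegrable (by fun_prop) _ _)
    (Continuous.aestronglyMeasurable (by fun_prop)) ?_ (by simp) ?_).2
  · refine .of_forall fun t ht r hr => hC (r, t) ⟨hr, ?_⟩
    rw [Set.uIoc_of_le zero_le_one] at ht
    exact Set.Ioc_subset_Icc_self ht
  · refine .of_forall fun t _ r _ => ?_
    have h1 : HasDerivAt (fun r => a t + b t * r) (b t) r := by
      simpa using ((hasDerivAt_id r).const_mul (b t)).const_add (a t)
    refine (((hφ _).comp r h1).const_mul (w t)).congr_deriv ?_
    ring

theorem hasDerivAt_segmentAverage_left {w φ φ' : ℝ → ℝ} (hw : Continuous w)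
    (hφ : ∀ y, HasDerivAt φ (φ' y) y) (hφ' : Continuous φ') (y z : ℝ) :
    HasDerivAt (fun y => segmentAverage w φ y z) (segmentAverage (fun t => w t * t) φ' y z) y := by
  have e (t y : ℝ) : z + t * (y - z) = (z - t * z) + t * y := by ring
  simp only [segmentAverage, e]
  exact hasDerivAt_integral_mul_comp_affine (a := fun t => z - t * z) (b := fun t => t) hw
    (by fun_prop) (by fun_prop) hφ hφ' y

theorem hasDerivAt_segmentAverage_right {w φ φ' : ℝ → ℝ} (hw : Continuous w)
    (hφ : ∀ y, HasDerivAt φ (φ' y) y) (hφ' : Continuous φ') (y z : ℝ) :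
    HasDerivAt (segmentAverage w φ y) (segmentAverage (fun t => w t * (1 - t)) φ' y z) z := by
  have e (t z : ℝ) : z + t * (y - z) = t * y + (1 - t) * z := by ring
  unfold segmentAverage
  simp only [e]
  exact hasDerivAt_integral_mul_comp_affine (a := fun t => t * y) (b := fun t => 1 - t) hw
    (by fun_prop) (by fun_prop) hφ hφ' z

theorem segmentAverage_self (w φ : ℝ → ℝ) (y : ℝ) :
    segmentAverage w φ y y = (∫ t in (0 : ℝ)..1, w t) * φ y := by
  simp [segmentAverage]

namespace RegularCoord

variable {x x₁ x₂ x₃ : ℝ → ℝ}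

/-- Hadamard's lemma: the difference quotient of `x` extends across the diagonal as an average of
`x₁`. It can be differentiated there without dividing by `y - z`, and its positivity makes its
logarithm regular. -/
theorem sub_eq_mul_segmentAverage (hx : RegularCoord x x₁ x₂ x₃) (y z : ℝ) :
    x y - x z = segmentAverage (fun _ => 1) x₁ y z * (y - z) := by
  have hc := hx.continuous_deriv
  have h := intervalIntegral.integral_eq_sub_of_hasDerivAt (a := 0) (b := 1)
    (f := fun t => x (z + t * (y - z))) (f' := fun t => x₁ (z + t * (y - z)) * (y - z))
    (fun t _ => by
      have h1 : HasDerivAt (fun t => z + t * (y - z)) (y - z) t := by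
        simpa using ((hasDerivAt_id t).mul_const (y - z)).const_add z
      exact (hx.hasDerivAt _).comp t h1)
    (Continuous.intervalIntegrable (by fun_prop) _ _)
  simp only [one_mul, zero_mul, add_zero, add_sub_cancel] at h
  rw [← h, intervalIntegral.integral_mul_const]
  simp [segmentAverage]

theorem segmentAverage_pos (hx : RegularCoord x x₁ x₂ x₃) (y z : ℝ) :
    0 < segmentAverage (fun _ => 1) x₁ y z := by
  have hc := hx.continuous_deriv
  refine intervalIntegral.intervalIntegral_pos_of_pos
    (Continuous.intervalIntegrable (by fun_prop) _ _) (fun t => ?_) one_pos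
  simpa using hx.deriv_pos _

end RegularCoord

/-- The logarithm of the slope of `x` between two points. -/
noncomputable def logSlope (x₁ : ℝ → ℝ) (y z : ℝ) : ℝ :=
  Real.log (segmentAverage (fun _ => 1) x₁ y z)

/-- The mixed second derivative of the logarithm of the slope of `x` between two points. It equals
`x'(y) x'(z) / (x(y) - x(z))² - 1 / (y - z)²` off the diagonal and a sixth of the Schwarzian
derivative of `x` on the diagonal. -/
noncomputable def schwarzianKernel (x₁ x₂ x₃ : ℝ → ℝ) (y z : ℝ) : ℝ :=
  segmentAverage (fun t => 1 * t * (1 - t)) x₃ y z / segmentAverage (fun _ => 1) x₁ y z -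
    segmentAverage (fun t => 1 * t) x₂ y z * segmentAverage (fun t => 1 * (1 - t)) x₂ y z /
      segmentAverage (fun _ => 1) x₁ y z ^ 2

namespace RegularCoord

variable {x x₁ x₂ x₃ : ℝ → ℝ}

theorem continuous_logSlope (hx : RegularCoord x x₁ x₂ x₃) :
    Continuous fun p : ℝ × ℝ => logSlope x₁ p.1 p.2 :=
  (continuous_segmentAverage continuous_const hx.continuous_deriv).log
    fun p => (hx.segmentAverage_pos p.1 p.2).ne'

theorem continuous_schwarzianKernel (hx : RegularCoord x x₁ x₂ x₃) :
    Continuous fun p : ℝ × ℝ => schwarzianKernel x₁ x₂ x₃ p.1 p.2 := by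
  have h0 := continuous_segmentAverage (w := fun _ => 1) continuous_const hx.continuous_deriv
  have h1 := continuous_segmentAverage (w := fun t => 1 * t) (by fun_prop) hx.continuous_deriv2
  have h2 := continuous_segmentAverage (w := fun t => 1 * (1 - t)) (by fun_prop)
    hx.continuous_deriv2
  have h3 := continuous_segmentAverage (w := fun t => 1 * t * (1 - t)) (by fun_prop)
    hx.continuous_deriv3
  have hp (p : ℝ × ℝ) := (hx.segmentAverage_pos p.1 p.2).ne'
  exact (h3.div h0 hp).sub ((h1.mul h2).div (h0.pow 2) fun p => pow_ne_zero 2 (hp p))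

theorem schwarzianKernel_self (hx : RegularCoord x x₁ x₂ x₃) (y : ℝ) :
    schwarzianKernel x₁ x₂ x₃ y y = x₃ y / (6 * x₁ y) - (x₂ y / x₁ y) ^ 2 / 4 := by
  have i1 : ∫ t in (0 : ℝ)..1, 1 * t = 1 / 2 := by simp
  have i2 : ∫ t in (0 : ℝ)..1, 1 * (1 - t) = 1 / 2 := by
    simp only [one_mul]
    rw [intervalIntegral.integral_sub (by simp) (by simp)]
    norm_num
  have i3 : ∫ t in (0 : ℝ)..1, 1 * t * (1 - t) = 1 / 6 := by
    have e : (fun t : ℝ => 1 * t * (1 - t)) = fun t => t - t ^ 2 := by funext t; ring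
    rw [e, intervalIntegral.integral_sub (by simp) (by simp)]
    norm_num [integral_pow]
  have := (hx.deriv_pos y).ne'
  simp only [schwarzianKernel, segmentAverage_self, i1, i2, i3]
  simp
  field_simp
  ring

theorem integral_schwarzianKernel (hx : RegularCoord x x₁ x₂ x₃)
    {f₁ f₂ : ℝ → ℂ} (hf₁ : IsTestFunction f₁) (hf₂ : IsTestFunction f₂) :
    ∫ p : ℝ × ℝ, (schwarzianKernel x₁ x₂ x₃ p.1 p.2 : ℂ) * (f₁ p.1 * f₂ p.2) =
      ∫ p : ℝ × ℝ, (logSlope x₁ p.1 p.2 : ℂ) * (deriv f₁ p.1 * deriv f₂ p.2) := by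
  have h0 := continuous_segmentAverage (w := fun _ => 1) continuous_const hx.continuous_deriv
  have h1 := continuous_segmentAverage (w := fun t => 1 * t) (by fun_prop) hx.continuous_deriv2
  have hp (p : ℝ × ℝ) := (hx.segmentAverage_pos p.1 p.2).ne'
  refine integral_mixed_deriv_mul_testFunction (A := fun y z => (logSlope x₁ y z : ℂ))
    -- The redundant factors `1` in the weights are those that the derivative lemmas for
    -- `segmentAverage` produce from the constant weight.
    (A₁ := fun y z => ((segmentAverage (fun t => 1 * t) x₂ y z /
      segmentAverage (fun _ => 1) x₁ y z : ℝ) : ℂ))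
    (A₁₂ := fun y z => (schwarzianKernel x₁ x₂ x₃ y z : ℂ)) (fun y z => ?_) (fun y z => ?_)
    (Complex.continuous_ofReal.comp hx.continuous_logSlope)
    (Complex.continuous_ofReal.comp (h1.div h0 hp))
    (Complex.continuous_ofReal.comp hx.continuous_schwarzianKernel) hf₁ hf₂
  · exact ((hasDerivAt_segmentAverage_left continuous_const hx.hasDerivAt_deriv
      hx.continuous_deriv2 y z).log (hp (y, z))).ofReal_comp
  · refine HasDerivAt.ofReal_comp (f := fun z => segmentAverage (fun t => 1 * t) x₂ y z /
      segmentAverage (fun _ => 1) x₁ y z) ?_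
    refine ((hasDerivAt_segmentAverage_right (by fun_prop) hx.hasDerivAt_deriv2
      hx.continuous_deriv3 y z).fun_div (hasDerivAt_segmentAverage_right continuous_const
      hx.hasDerivAt_deriv hx.continuous_deriv2 y z) (hp (y, z))).congr_deriv ?_
    have := hp (y, z)
    simp only at this
    rw [schwarzianKernel]
    field_simp

end RegularCoord

/-! ### The kernel of the vacuum correlation -/

theorem ofReal_add_I_mul_ne_zero {ε : ℝ} (hε : 0 < ε) (s t : ℝ) :
    (ε + Complex.I * (s - t) : ℂ) ≠ 0 := by
  intro h
  have := congrArg Complex.re h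
  simp at this
  exact hε.ne' this

theorem ofReal_add_I_mul_mem_slitPlane {ε : ℝ} (hε : 0 < ε) (s t : ℝ) :
    (ε + Complex.I * (s - t) : ℂ) ∈ Complex.slitPlane :=
  Or.inl (by simpa using hε)

namespace RegularCoord

variable {x x₁ x₂ x₃ : ℝ → ℝ}

/-- With `a = ε + i(x(y) - x(z))`, the kernel `x₁(y) x₁(z) / a²` is minus the mixed derivative of
`log a`. Since `Re a = ε > 0`, the principal branch is differentiable everywhere. The logarithm is
mild enough on the diagonal for `ε → 0`, unlike `1/a²`. -/
theorem integral_exp_mul_derivModes_eq_log (hx : RegularCoord x x₁ x₂ x₃)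
    {f₁ f₂ : ℝ → ℂ} (hf₁ : IsTestFunction f₁) (hf₂ : IsTestFunction f₂) {ε : ℝ} (hε : 0 < ε) :
    ∫ k : ℝ, Complex.exp (-ε * k) * (derivModes x f₁ k * derivModes x f₂ (-k)) ∂momentumMeasure =
      -(1 / (4 * Real.pi)) * ∫ p : ℝ × ℝ, Complex.log (ε + Complex.I * (x p.1 - x p.2)) *
        (deriv f₁ p.1 * deriv f₂ p.2) := by
  have hcx := hx.continuous
  have hcx1 := hx.continuous_deriv
  have hne (y z : ℝ) := ofReal_add_I_mul_ne_zero hε (x y) (x z)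
  have key := integral_mixed_deriv_mul_testFunction
    (A := fun y z => Complex.log (ε + Complex.I * (x y - x z)))
    (A₁ := fun y z => Complex.I * x₁ y / (ε + Complex.I * (x y - x z)))
    (A₁₂ := fun y z => -((x₁ y * x₁ z : ℂ) / (ε + Complex.I * (x y - x z)) ^ 2))
    (fun y z => ?_) (fun y z => ?_) ?_ ?_ ?_ hf₁ hf₂
  · rw [integral_exp_mul_derivModes hx hf₁ hf₂ hε, ← key]
    simp_rw [neg_mul, integral_neg, mul_neg, neg_neg]
  · refine HasDerivAt.clog_real ?_ (ofReal_add_I_mul_mem_slitPlane hε _ _)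
    exact ((((hx.hasDerivAt y).ofReal_comp).sub_const _).const_mul _).const_add _
  · have h1 : HasDerivAt (fun z : ℝ => (ε + Complex.I * (x y - x z) : ℂ))
        (Complex.I * -(x₁ z : ℂ)) z :=
      ((((hx.hasDerivAt z).ofReal_comp).const_sub _).const_mul _).const_add _
    refine ((hasDerivAt_const z (Complex.I * x₁ y : ℂ)).fun_div h1 (hne y z)).congr_deriv ?_
    rw [← neg_div]
    congr 1
    linear_combination (x₁ y * x₁ z : ℂ) * Complex.I_sq
  · exact Continuous.clog (by fun_prop) fun p => ofReal_add_I_mul_mem_slitPlane hε _ _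
  · exact Continuous.div (by fun_prop) (by fun_prop) fun p => hne _ _
  · exact (Continuous.div (by fun_prop) (by fun_prop) fun p => pow_ne_zero 2 (hne _ _)).neg

end RegularCoord

/-- The modulus of `ε + iDs` lies between those of `ε + is` and `D(ε + is)`, so the real parts
differ by at most `|log D|`; each argument is at most `π` in absolute value. The bound does not
depend on `ε`, as dominated convergence requires. -/
theorem norm_log_sub_log_le {ε D s : ℝ} (hε : 0 < ε) (hD : 0 < D) :
    ‖Complex.log (ε + Complex.I * (D * s : ℝ)) - Complex.log (ε + Complex.I * s)‖ ≤
      |Real.log D| + 2 * Real.pi := by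
  set a : ℂ := ε + Complex.I * (D * s : ℝ)
  set b : ℂ := ε + Complex.I * s
  have ha : 0 < ‖a‖ := norm_pos_iff.2 fun h => by
    have := congrArg Complex.re h; simp [a] at this; exact hε.ne' this
  have hb : 0 < ‖b‖ := norm_pos_iff.2 fun h => by
    have := congrArg Complex.re h; simp [b] at this; exact hε.ne' this
  have na : ‖a‖ ^ 2 = ε ^ 2 + D ^ 2 * s ^ 2 := by
    rw [Complex.sq_norm, Complex.normSq_apply]; simp [a]; ring
  have nb : ‖b‖ ^ 2 = ε ^ 2 + s ^ 2 := by
    rw [Complex.sq_norm, Complex.normSq_apply]; simp [b]; ring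
  have hre : |Real.log ‖a‖ - Real.log ‖b‖| ≤ |Real.log D| := by
    rcases le_total 1 D with h | h
    · have h1 : ‖b‖ ≤ ‖a‖ := by
        rw [← sq_le_sq₀ hb.le ha.le, na, nb]
        nlinarith [mul_le_mul_of_nonneg_right (one_le_pow₀ h : (1 : ℝ) ≤ D ^ 2) (sq_nonneg s)]
      have h2 : ‖a‖ ≤ D * ‖b‖ := by
        rw [← sq_le_sq₀ ha.le (by positivity), mul_pow, na, nb]
        nlinarith [mul_le_mul_of_nonneg_right (one_le_pow₀ h : (1 : ℝ) ≤ D ^ 2) (sq_nonneg ε)]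
      have h3 := Real.log_le_log ha h2
      rw [Real.log_mul hD.ne' hb.ne'] at h3
      rw [abs_of_nonneg (sub_nonneg.2 (Real.log_le_log hb h1)), abs_of_nonneg (Real.log_nonneg h)]
      linarith
    · have h1 : ‖a‖ ≤ ‖b‖ := by
        rw [← sq_le_sq₀ ha.le hb.le, na, nb]
        nlinarith [mul_le_mul_of_nonneg_right (pow_le_one₀ hD.le h : D ^ 2 ≤ 1) (sq_nonneg s)]
      have h2 : D * ‖b‖ ≤ ‖a‖ := by
        rw [← sq_le_sq₀ (by positivity) ha.le, mul_pow, na, nb]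
        nlinarith [mul_le_mul_of_nonneg_right (pow_le_one₀ hD.le h : D ^ 2 ≤ 1) (sq_nonneg ε)]
      have h3 := Real.log_le_log (by positivity) h2
      rw [Real.log_mul hD.ne' hb.ne'] at h3
      rw [abs_of_nonpos (sub_nonpos.2 (Real.log_le_log ha h1)),
        abs_of_nonpos (Real.log_nonpos hD.le h)]
      linarith
  refine (Complex.norm_le_abs_re_add_abs_im _).trans (add_le_add ?_ ?_)
  · simpa [Complex.log_re] using hre
  · rw [Complex.sub_im, Complex.log_im, Complex.log_im]
    refine (abs_sub _ _).trans ?_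
    linarith [Complex.abs_arg_le_pi a, Complex.abs_arg_le_pi b]

/-- At `ε = 0` the points `iDs` and `is` have the positive ratio `D`, so their arguments coincide
and only `log D` survives. -/
theorem tendsto_log_sub_log {D s : ℝ} (hD : 0 < D) (hs : s ≠ 0) :
    Tendsto (fun ε : ℝ => Complex.log (ε + Complex.I * (D * s : ℝ)) -
      Complex.log (ε + Complex.I * s)) (𝓝[>] 0) (𝓝 (Real.log D : ℂ)) := by
  have h (t : ℝ) (ht : t ≠ 0) : Tendsto (fun ε : ℝ => Complex.log (ε + Complex.I * t)) (𝓝[>] 0)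
      (𝓝 (Complex.log (Complex.I * t))) := by
    have h1 : Tendsto (fun ε : ℝ => (ε + Complex.I * t : ℂ)) (𝓝 0)
        (𝓝 ((0 : ℝ) + Complex.I * t)) := Continuous.tendsto (by fun_prop) 0
    rw [Complex.ofReal_zero, zero_add] at h1
    exact (h1.mono_left nhdsWithin_le_nhds).clog (Or.inr (by simpa using ht))
  have h2 := (h (D * s) (mul_ne_zero hD.ne' hs)).sub (h s hs)
  have e : Complex.log (Complex.I * ((D * s : ℝ) : ℂ)) - Complex.log (Complex.I * s) =
      Real.log D := by
    rw [show Complex.I * ((D * s : ℝ) : ℂ) = D * (Complex.I * s) by push_cast; ring,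
      Complex.log_ofReal_mul hD (mul_ne_zero Complex.I_ne_zero (by exact_mod_cast hs)),
      add_sub_cancel_right]
  rwa [e] at h2

theorem ae_fst_ne_snd : ∀ᵐ p : ℝ × ℝ, p.1 ≠ p.2 := by
  rw [Measure.volume_eq_prod]
  refine (Measure.ae_prod_iff_ae_ae (p := fun p : ℝ × ℝ => p.1 ≠ p.2)
    (measurableSet_eq_fun measurable_fst measurable_snd).compl).2 (.of_forall fun y => ?_)
  filter_upwards [Measure.ae_ne volume y] with z hz
  exact hz.symm

/-- The two singular kernels are not locally integrable at the diagonal, but their singularities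
cancel. Under a common cutoff both correlations are integrals of logarithms against `f₁' f₂'`; the
difference of logarithms converges boundedly on the supports to `logSlope`, and integrating by parts
back gives a continuous kernel. -/
theorem vacuumCorrelation_sub_id {x x₁ x₂ x₃ : ℝ → ℝ} (hx : RegularCoord x x₁ x₂ x₃)
    {f₁ f₂ : ℝ → ℂ} (hf₁ : IsTestFunction f₁) (hf₂ : IsTestFunction f₂) :
    vacuumCorrelation x f₁ f₂ - vacuumCorrelation id f₁ f₂ =
      ∫ p : ℝ × ℝ, ((-(1 / (4 * Real.pi)) * schwarzianKernel x₁ x₂ x₃ p.1 p.2 : ℝ) : ℂ) *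
        (f₁ p.1 * f₂ p.2) := by
  have hcx := hx.continuous
  have hcL := hx.continuous_logSlope
  have l₁ := (tendsto_vacuumCorrelation hx hf₁ hf₂).sub
    (tendsto_vacuumCorrelation regularCoord_id hf₁ hf₂)
  have hint (ε : ℝ) (hε : 0 < ε) (u : ℝ → ℝ) (hu : Continuous u) : Integrable fun p : ℝ × ℝ =>
      Complex.log (ε + Complex.I * (u p.1 - u p.2)) * (deriv f₁ p.1 * deriv f₂ p.2) :=
    hf₁.deriv.integrable_mul_prod hf₂.deriv (K := fun p => Complex.log (ε + Complex.I *
      (u p.1 - u p.2))) (Continuous.clog (by fun_prop)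
        fun p => ofReal_add_I_mul_mem_slitPlane hε _ _)
  have l₂ : Tendsto (fun ε : ℝ => ∫ p : ℝ × ℝ,
      (Complex.log (ε + Complex.I * (x p.1 - x p.2)) -
        Complex.log (ε + Complex.I * (id p.1 - id p.2))) * (deriv f₁ p.1 * deriv f₂ p.2)) (𝓝[>] 0)
      (𝓝 (∫ p : ℝ × ℝ, (logSlope x₁ p.1 p.2 : ℂ) * (deriv f₁ p.1 * deriv f₂ p.2))) := by
    have hxD (p : ℝ × ℝ) : (x p.1 - x p.2 : ℂ) =
        ((segmentAverage (fun _ => 1) x₁ p.1 p.2 * (p.1 - p.2) : ℝ) : ℂ) := by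
      rw [← hx.sub_eq_mul_segmentAverage]; push_cast; rfl
    refine tendsto_integral_filter_of_dominated_convergence
      (fun p => (|logSlope x₁ p.1 p.2| + 2 * Real.pi) * ‖deriv f₁ p.1 * deriv f₂ p.2‖) ?_ ?_ ?_ ?_
    · filter_upwards [self_mem_nhdsWithin] with ε hε
      simp_rw [sub_mul]
      exact ((hint ε hε x hcx).sub (hint ε hε id continuous_id)).1
    · filter_upwards [self_mem_nhdsWithin] with ε hε
      filter_upwards with p
      rw [norm_mul]
      gcongr
      rw [hxD, ← Complex.ofReal_sub (id p.1)]
      exact norm_log_sub_log_le hε (hx.segmentAverage_pos _ _)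
    · have := (hf₁.deriv.integrable_mul_prod hf₂.deriv
        (K := fun p => ((|logSlope x₁ p.1 p.2| + 2 * Real.pi : ℝ) : ℂ)) (by fun_prop)).norm
      refine this.congr (.of_forall fun p => ?_)
      simp only
      rw [norm_mul, Complex.norm_real, Real.norm_of_nonneg (by positivity)]
    · filter_upwards [ae_fst_ne_snd] with p hp
      refine Tendsto.mul_const _ ?_
      rw [hxD, ← Complex.ofReal_sub (id p.1)]
      exact tendsto_log_sub_log (hx.segmentAverage_pos _ _) (sub_ne_zero.2 hp)
  have l₃ := (l₂.const_mul (-(1 / (4 * Real.pi)) : ℂ)).congr' (f₂ := fun ε : ℝ =>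
    (∫ k : ℝ, Complex.exp (-ε * k) * (derivModes x f₁ k * derivModes x f₂ (-k)) ∂momentumMeasure) -
    ∫ k : ℝ, Complex.exp (-ε * k) * (derivModes id f₁ k * derivModes id f₂ (-k)) ∂momentumMeasure)
    (by
      filter_upwards [self_mem_nhdsWithin] with ε hε
      simp_rw [sub_mul]
      rw [hx.integral_exp_mul_derivModes_eq_log hf₁ hf₂ hε,
        regularCoord_id.integral_exp_mul_derivModes_eq_log hf₁ hf₂ hε, ← mul_sub,
        integral_sub (hint ε hε x hcx) (hint ε hε id continuous_id)])
  rw [tendsto_nhds_unique l₁ l₃, ← hx.integral_schwarzianKernel hf₁ hf₂, ← integral_const_mul]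
  congr 1
  funext p
  push_cast
  ring

/-! ### The vacuum correlation away from the diagonal. -/

/-- The kernel of the vacuum correlation of the incoming field off the diagonal. -/
noncomputable def vacuumKernel (y z : ℝ) : ℂ := -(1 / (4 * Real.pi)) / (y - z) ^ 2

theorem continuousOn_vacuumKernel :
    ContinuousOn (fun p : ℝ × ℝ => vacuumKernel p.1 p.2) {p | p.1 ≠ p.2} := by
  refine ContinuousOn.div continuousOn_const (by fun_prop) fun p hp => pow_ne_zero 2 ?_
  exact sub_ne_zero.2 (by exact_mod_cast hp)

theorem isOpen_fst_ne_snd : IsOpen {p : ℝ × ℝ | p.1 ≠ p.2} :=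
  isOpen_ne_fun continuous_fst continuous_snd

/-- For supports that avoid the diagonal no logarithm is needed: `|y - z| ≤ |ε + i(y - z)|`, so the
limiting kernel itself dominates. The sign of `vacuumKernel` is `1/i²`. -/
theorem vacuumCorrelation_id {f₁ f₂ : ℝ → ℂ} (hf₁ : IsTestFunction f₁) (hf₂ : IsTestFunction f₂)
    (hs : tsupport f₁ ×ˢ tsupport f₂ ⊆ {p : ℝ × ℝ | p.1 ≠ p.2}) :
    vacuumCorrelation id f₁ f₂ =
      ∫ p : ℝ × ℝ, vacuumKernel p.1 p.2 * (f₁ p.1 * f₂ p.2) := by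
  have hi := hf₁.integrable_mul_prod_of_continuousOn hf₂ isOpen_fst_ne_snd
    continuousOn_vacuumKernel hs
  refine tendsto_nhds_unique (tendsto_vacuumCorrelation regularCoord_id hf₁ hf₂) ?_
  have l : Tendsto (fun ε : ℝ => ∫ p : ℝ × ℝ, 1 / (4 * Real.pi) *
      (1 / (ε + Complex.I * (p.1 - p.2)) ^ 2 * (f₁ p.1 * f₂ p.2) : ℂ)) (𝓝[>] 0)
      (𝓝 (∫ p : ℝ × ℝ, vacuumKernel p.1 p.2 * (f₁ p.1 * f₂ p.2))) := by
    refine tendsto_integral_filter_of_dominated_convergence _ ?_ ?_ hi.norm ?_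
    · filter_upwards [self_mem_nhdsWithin] with ε hε
      refine ((hf₁.integrable_mul_prod hf₂ (K := fun p => 1 / (ε + Complex.I * (p.1 - p.2)) ^ 2)
        ?_).const_mul _).1
      exact Continuous.div (by fun_prop) (by fun_prop)
        fun p => pow_ne_zero 2 (ofReal_add_I_mul_ne_zero hε _ _)
    · filter_upwards with ε
      filter_upwards [ae_fst_ne_snd] with p hp
      have h0 : 0 < ‖(p.1 - p.2 : ℂ)‖ := norm_pos_iff.2 (sub_ne_zero.2 (by exact_mod_cast hp))
      have h1 : ‖(p.1 - p.2 : ℂ)‖ ≤ ‖(ε + Complex.I * (p.1 - p.2) : ℂ)‖ := by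
        rw [← Complex.ofReal_sub, Complex.norm_real, Real.norm_eq_abs]
        simpa using Complex.abs_im_le_norm (ε + Complex.I * ((p.1 - p.2 : ℝ) : ℂ))
      rw [vacuumKernel, ← mul_assoc, norm_mul, norm_mul _ (f₁ p.1 * f₂ p.2), mul_one_div,
        norm_div _ (_ ^ 2), norm_div (-_), norm_neg, norm_pow, norm_pow]
      gcongr
    · filter_upwards [ae_fst_ne_snd] with p hp
      have h0 : (p.1 - p.2 : ℂ) ≠ 0 := sub_ne_zero.2 (by exact_mod_cast hp)
      have hb : Tendsto (fun ε : ℝ => (ε + Complex.I * (p.1 - p.2) : ℂ)) (𝓝[>] 0)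
          (𝓝 ((0 : ℝ) + Complex.I * (p.1 - p.2))) :=
        (Continuous.tendsto (by fun_prop) 0).mono_left nhdsWithin_le_nhds
      rw [Complex.ofReal_zero, zero_add] at hb
      have e : vacuumKernel p.1 p.2 * (f₁ p.1 * f₂ p.2) = 1 / (4 * Real.pi) *
          (1 / (Complex.I * (p.1 - p.2)) ^ 2 * (f₁ p.1 * f₂ p.2) : ℂ) := by
        rw [vacuumKernel, mul_pow, Complex.I_sq]
        field_simp
      rw [e]
      exact (((tendsto_const_nhds (x := (1 : ℂ))).div (hb.pow 2) (pow_ne_zero 2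
        (mul_ne_zero Complex.I_ne_zero h0))).mul_const _).const_mul _
  refine l.congr' ?_
  filter_upwards [self_mem_nhdsWithin] with ε hε
  rw [integral_exp_mul_derivModes regularCoord_id hf₁ hf₂ hε, integral_const_mul]
  simp

/-! ### The one-particle contribution -/

open scoped FourierTransform in
theorem incomingMomentum_id_eq_fourier (g : ℝ → ℂ) (k : ℝ) :
    incomingMomentum id g k = ((Real.sqrt (2 * Real.pi) : ℝ) : ℂ)⁻¹ * 𝓕 g (k / (2 * Real.pi)) := by
  rw [incomingMomentum, Real.fourier_real_eq_integral_exp_smul]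
  congr 2
  funext y
  rw [smul_eq_mul]
  congr 2
  have : (Real.pi : ℂ) ≠ 0 := by exact_mod_cast Real.pi_ne_zero
  push_cast [id]
  field_simp

theorem integrable_incomingMomentum_id (g : 𝓢(ℝ, ℂ)) : Integrable (incomingMomentum id g) := by
  have h : incomingMomentum id g = fun k => ((Real.sqrt (2 * Real.pi) : ℝ) : ℂ)⁻¹ *
      (SchwartzMap.fourierTransformCLM ℂ g) (k / (2 * Real.pi)) :=
    funext fun k => incomingMomentum_id_eq_fourier g k
  rw [h]
  exact ((SchwartzMap.integrable _).comp_div (by positivity)).const_mul _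

open scoped FourierTransform in
theorem integral_incomingMomentum_id_mul_exp (g : 𝓢(ℝ, ℂ)) (s : ℝ) :
    ((Real.sqrt (2 * Real.pi) : ℝ) : ℂ)⁻¹ * ∫ k : ℝ, incomingMomentum id g k *
      Complex.exp (Complex.I * k * s) = g s := by
  have hinv := g.integrable.fourierInv_fourier_eq
    (SchwartzMap.integrable (SchwartzMap.fourierTransformCLM ℂ g))
    (g.continuous.continuousAt (x := s))
  have hpi : (Real.pi : ℂ) ≠ 0 := by exact_mod_cast Real.pi_ne_zero
  have hc : ((Real.sqrt (2 * Real.pi) : ℝ) : ℂ)⁻¹ ^ 2 = (2 * (Real.pi : ℂ))⁻¹ := by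
    rw [inv_pow, ← Complex.ofReal_pow, Real.sq_sqrt (by positivity)]
    push_cast; rfl
  set H : ℝ → ℂ := fun w => Complex.exp (((2 * Real.pi * inner ℝ w s : ℝ) : ℂ) * Complex.I) •
    𝓕 (g : ℝ → ℂ) w with hH
  have e (k : ℝ) : incomingMomentum id g k * Complex.exp (Complex.I * k * s) =
      ((Real.sqrt (2 * Real.pi) : ℝ) : ℂ)⁻¹ * H (k / (2 * Real.pi)) := by
    have e' : Complex.I * k * s =
        ((2 * Real.pi * inner ℝ (k / (2 * Real.pi)) s : ℝ) : ℂ) * Complex.I := by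
      simp only [RCLike.inner_apply, conj_trivial]
      push_cast
      field_simp
    rw [incomingMomentum_id_eq_fourier, e']
    simp only [hH, smul_eq_mul]
    ring
  rw [Real.fourierInv_eq'] at hinv
  simp_rw [e]
  rw [integral_const_mul, Measure.integral_comp_div, hinv, ← mul_assoc, ← sq, hc,
    abs_of_pos (by positivity), Complex.real_smul]
  push_cast
  field_simp

/-- The incoming wave function only has positive momenta. -/
theorem integral_Ioi_incomingMomentum_id_mul_exp (g : 𝓢(ℝ, ℂ))
    (hg : ∀ k : ℝ, k < 0 → incomingMomentum id g k = 0) (s : ℝ) :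
    ((Real.sqrt (2 * Real.pi) : ℝ) : ℂ)⁻¹ * ∫ k in Set.Ioi (0 : ℝ), incomingMomentum id g k *
      Complex.exp (Complex.I * k * s) = g s := by
  rw [← integral_incomingMomentum_id_mul_exp g s, ← integral_Ici_eq_integral_Ioi,
    setIntegral_eq_integral_of_forall_compl_eq_zero]
  intro k hk
  rw [hg k (not_le.1 hk), zero_mul]

/-- The factor `-ik` from the derivative cancels `1/2k` down to `-i/2`. What remains is Fourier
inversion of `g` at `x(y)`; the half-line suffices because the transform of `g` vanishes for
negative momenta. -/
theorem integral_incomingMomentum_mul_derivModes_neg {x x₁ x₂ x₃ : ℝ → ℝ}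
    (hx : RegularCoord x x₁ x₂ x₃) (g : 𝓢(ℝ, ℂ))
    (hg : ∀ k : ℝ, k < 0 → incomingMomentum id g k = 0) {f : ℝ → ℂ} (hf : IsTestFunction f) :
    ∫ k, incomingMomentum id g k * derivModes x f (-k) ∂momentumMeasure =
      ∫ y, -(Complex.I / 2) * x₁ y * g (x y) * f y := by
  have hcx := hx.continuous
  have hcx1 := hx.continuous_deriv
  have hγ := (integrable_incomingMomentum_id g).integrableOn (s := Set.Ioi 0)
  have hfx : Integrable fun y => (x₁ y : ℂ) * f y := hf.integrable_mul (by fun_prop)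
  set c : ℂ := ((Real.sqrt (2 * Real.pi) : ℝ) : ℂ)⁻¹ with hc
  set F : ℝ → ℝ → ℂ := fun k y => incomingMomentum id g k * Complex.exp (Complex.I * k * x y) *
    (x₁ y * f y) with hF
  have hFi : Integrable (Function.uncurry F) ((volume.restrict (Set.Ioi (0 : ℝ))).prod volume) := by
    refine (hγ.mul_prod hfx).bdd_mul (c := 1)
      (f := fun q : ℝ × ℝ => Complex.exp (-Complex.I * (-q.1 : ℝ) * x q.2))
      (by fun_prop) (by filter_upwards with q; rw [norm_cexp_neg_I_mul]) |>.congr ?_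
    filter_upwards with q
    simp only [Function.uncurry, hF, Complex.ofReal_neg, neg_mul, mul_neg, neg_neg]
    ring
  calc _ = ∫ k in Set.Ioi (0 : ℝ), -(Complex.I / 2) * c * ∫ y, F k y := by
        rw [integral_momentumMeasure]
        refine setIntegral_congr_fun measurableSet_Ioi fun k hk => ?_
        have hk0 : (k : ℂ) ≠ 0 := by exact_mod_cast (ne_of_gt hk)
        have e : ∫ y, F k y = incomingMomentum id g k *
            ∫ y, Complex.exp (-Complex.I * (-k : ℝ) * x y) * (x₁ y * f y) := by
          rw [← integral_const_mul]
          congr 1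
          funext y
          simp only [hF, Complex.ofReal_neg, neg_mul, mul_neg, neg_neg]
          ring
        rw [e, derivModes_eq hx hf]
        nth_rewrite 2 [incomingMomentum]
        rw [← hc]
        generalize (∫ y, Complex.exp (-Complex.I * (-k : ℝ) * x y) * (x₁ y * f y)) = A
        push_cast
        field_simp
    _ = -(Complex.I / 2) * c * ∫ y, ∫ k in Set.Ioi (0 : ℝ), F k y := by
        rw [integral_const_mul, integral_integral_swap hFi]
    _ = _ := by
        rw [← integral_const_mul]
        congr 1
        funext y
        rw [← integral_Ioi_incomingMomentum_id_mul_exp g hg (x y)]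
        simp only [hF]
        rw [integral_mul_const]
        ring

theorem derivModes_conj_neg (x : ℝ → ℝ) (f : ℝ → ℂ) (k : ℝ) :
    derivModes x (fun y => conj (f y)) (-k) = conj (derivModes x f k) := by
  have hd : deriv (fun y => conj (f y)) = fun y => conj (deriv f y) :=
    funext fun y => deriv.star (f := f)
  simp only [derivModes, hd, incomingMomentum, map_mul, map_inv₀, Complex.conj_ofReal,
    ← integral_conj, ← Complex.exp_conj]
  simp

theorem IsTestFunction.conj {f : ℝ → ℂ} (hf : IsTestFunction f) :
    IsTestFunction fun y => conj (f y) where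
  contDiff := Complex.conjCLE.contDiff.comp hf.contDiff
  hasCompactSupport := hf.hasCompactSupport.comp_left (map_zero _)

theorem integral_derivModes_mul_conj_incomingMomentum {x x₁ x₂ x₃ : ℝ → ℝ}
    (hx : RegularCoord x x₁ x₂ x₃) (g : 𝓢(ℝ, ℂ))
    (hg : ∀ k : ℝ, k < 0 → incomingMomentum id g k = 0) {f : ℝ → ℂ} (hf : IsTestFunction f) :
    ∫ k, derivModes x f k * conj (incomingMomentum id g k) ∂momentumMeasure =
      ∫ y, Complex.I / 2 * x₁ y * conj (g (x y)) * f y := by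
  have h := congrArg conj (integral_incomingMomentum_mul_derivModes_neg hx g hg hf.conj)
  simp_rw [derivModes_conj_neg, ← integral_conj, map_mul, Complex.conj_conj] at h
  simp_rw [mul_comm (derivModes x f _), h]
  simp [neg_div, map_ofNat]

/-- The kernel of the one-particle contribution to the correlation. -/
noncomputable def particleKernel (x x₁ : ℝ → ℝ) (g : ℝ → ℂ) (y z : ℝ) : ℂ :=
  x₁ y * x₁ z / 4 * (conj (g (x y)) * g (x z) + g (x y) * conj (g (x z)))

theorem particleKernel_self (x x₁ : ℝ → ℝ) (g : ℝ → ℂ) (y : ℝ) :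
    particleKernel x x₁ g y y = ((x₁ y ^ 2 * ‖g (x y)‖ ^ 2 / 2 : ℝ) : ℂ) := by
  rw [particleKernel, Complex.conj_mul', Complex.mul_conj']
  push_cast
  ring

theorem particleCorrelation_eq {x x₁ x₂ x₃ : ℝ → ℝ}
    (hx : RegularCoord x x₁ x₂ x₃) (g : 𝓢(ℝ, ℂ))
    (hg : ∀ k : ℝ, k < 0 → incomingMomentum id g k = 0) {f₁ f₂ : ℝ → ℂ} (hf₁ : IsTestFunction f₁)
    (hf₂ : IsTestFunction f₂) :
    particleCorrelation x (fun k => conj (incomingMomentum id g k)) f₁ f₂ =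
      ∫ p : ℝ × ℝ, particleKernel x x₁ g p.1 p.2 * (f₁ p.1 * f₂ p.2) := by
  have hcx := hx.continuous
  have hcx1 := hx.continuous_deriv
  have hcg := g.continuous
  have i₁ {f : ℝ → ℂ} (hf : IsTestFunction f) :
      Integrable fun y => -(Complex.I / 2) * x₁ y * g (x y) * f y :=
    hf.integrable_mul (by fun_prop)
  have i₂ {f : ℝ → ℂ} (hf : IsTestFunction f) :
      Integrable fun y => Complex.I / 2 * x₁ y * conj (g (x y)) * f y :=
    hf.integrable_mul (h := fun y => Complex.I / 2 * x₁ y * conj (g (x y)))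
      (by have := Complex.continuous_conj; fun_prop)
  simp only [particleCorrelation, Complex.conj_conj,
    integral_incomingMomentum_mul_derivModes_neg hx g hg hf₁,
    integral_incomingMomentum_mul_derivModes_neg hx g hg hf₂,
    integral_derivModes_mul_conj_incomingMomentum hx g hg hf₁,
    integral_derivModes_mul_conj_incomingMomentum hx g hg hf₂]
  rw [← integral_prod_mul, ← integral_prod_mul,
    ← integral_add ((i₂ hf₁).mul_prod (i₁ hf₂)) ((i₁ hf₁).mul_prod (i₂ hf₂)),
    Measure.volume_eq_prod]
  congr 1
  funext p
  rw [particleKernel]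
  linear_combination (-(1 / 4) * x₁ p.1 * x₁ p.2 * f₁ p.1 * f₂ p.2 *
    (conj (g (x p.1)) * g (x p.2) + g (x p.1) * conj (g (x p.2)))) * Complex.I_sq

/-! ### Uniqueness of kernels -/

theorem isTestFunction_contDiffBump {c : ℝ} (b : ContDiffBump c) :
    IsTestFunction fun y => ((b y : ℝ) : ℂ) where
  contDiff := Complex.ofRealCLM.contDiff.comp b.contDiff
  hasCompactSupport := b.hasCompactSupport.comp_left Complex.ofReal_zero

theorem tsupport_ofReal_contDiffBump {c : ℝ} (b : ContDiffBump c) :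
    tsupport (fun y => ((b y : ℝ) : ℂ)) ⊆ Metric.closedBall c b.rOut := by
  rw [← b.tsupport_eq]
  exact closure_mono fun y hy => by
    rw [Function.mem_support] at hy ⊢
    exact fun h => hy (by rw [h, Complex.ofReal_zero])

/-- If the difference `F` of the kernels were nonzero at `p`, then `Re (conj (F p) · F)` would be
positive on a small ball around `p`, and testing with a bump there would contradict the equality of
the functionals. Products of one-variable bumps suffice because balls of the sup metric are products
of intervals. -/
theorem IsKernelOn.unique {B : (ℝ → ℂ) → (ℝ → ℂ) → ℂ} {S : Set (ℝ × ℝ)} {K K' : ℝ → ℝ → ℂ}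
    (hS : IsOpen S) (h : IsKernelOn B S K) (h' : IsKernelOn B S K') {p : ℝ × ℝ} (hp : p ∈ S) :
    K p.1 p.2 = K' p.1 p.2 := by
  by_contra hne
  set F : ℝ × ℝ → ℂ := fun q => K q.1 q.2 - K' q.1 q.2 with hF
  have hFc : ContinuousOn F S := h.1.sub h'.1
  have hFp : F p ≠ 0 := sub_ne_zero.2 hne
  set φ : ℝ × ℝ → ℝ := fun q => (conj (F p) * F q).re with hφ
  have hφc : ContinuousOn φ S :=
    Complex.continuous_re.comp_continuousOn (continuousOn_const.mul hFc)
  have hφp : 0 < φ p := by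
    simp only [hφ]
    rw [Complex.conj_mul', ← Complex.ofReal_pow, Complex.ofReal_re]
    positivity
  obtain ⟨r, hr, hrU⟩ := Metric.nhds_basis_closedBall.mem_iff.1
    ((hφc.isOpen_inter_preimage hS isOpen_Ioi).mem_nhds ⟨hp, hφp⟩)
  let b₁ : ContDiffBump p.1 := ⟨r / 2, r, by positivity, by linarith⟩
  let b₂ : ContDiffBump p.2 := ⟨r / 2, r, by positivity, by linarith⟩
  have t₁ := isTestFunction_contDiffBump b₁
  have t₂ := isTestFunction_contDiffBump b₂
  have hsub : tsupport (fun y => ((b₁ y : ℝ) : ℂ)) ×ˢ tsupport (fun y => ((b₂ y : ℝ) : ℂ)) ⊆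
      Metric.closedBall p r := by
    rw [← closedBall_prod_same p.1 p.2 r]
    exact Set.prod_mono (tsupport_ofReal_contDiffBump b₁) (tsupport_ofReal_contDiffBump b₂)
  have hsS := (hsub.trans hrU).trans Set.inter_subset_left
  have e₁ := h.2 _ _ t₁.contDiff t₁.hasCompactSupport t₂.contDiff t₂.hasCompactSupport hsS
  have e₂ := h'.2 _ _ t₁.contDiff t₁.hasCompactSupport t₂.contDiff t₂.hasCompactSupport hsS
  simp_rw [mul_assoc] at e₁ e₂
  have i₁ := t₁.integrable_mul_prod_of_continuousOn t₂ hS h.1 hsS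
  have i₂ := t₁.integrable_mul_prod_of_continuousOn t₂ hS h'.1 hsS
  have i := (t₁.integrable_mul_prod_of_continuousOn t₂ hS hFc hsS).const_mul (conj (F p))
  have hz : ∫ q : ℝ × ℝ, conj (F p) * (F q * (((b₁ q.1 : ℝ) : ℂ) * ((b₂ q.2 : ℝ) : ℂ))) = 0 := by
    simp only [hF, sub_mul]
    rw [integral_const_mul, integral_sub i₁ i₂, ← e₁, ← e₂, sub_self, mul_zero]
  have hre (q : ℝ × ℝ) : (conj (F p) * (F q * (((b₁ q.1 : ℝ) : ℂ) * ((b₂ q.2 : ℝ) : ℂ)))).re =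
      φ q * (b₁ q.1 * b₂ q.2) := by
    simp only [hφ]
    rw [← mul_assoc, ← Complex.ofReal_mul, Complex.re_mul_ofReal]
  have hcont : Continuous fun q : ℝ × ℝ => φ q * (b₁ q.1 * b₂ q.2) := by
    simp_rw [← hre]
    exact Complex.continuous_re.comp
      (continuous_const.mul (t₁.continuous_mul_prod t₂ hS hFc hsS))
  have hcs : HasCompactSupport fun q : ℝ × ℝ => φ q * (b₁ q.1 * b₂ q.2) := by
    simp_rw [← hre]
    exact ((t₁.hasCompactSupport_prod t₂).mul_left.mul_left).comp_left Complex.zero_re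
  have hpos := hcont.integral_pos_of_hasCompactSupport_nonneg_nonzero (μ := volume) (x := p) hcs
    (fun q => ?_) ?_
  · have := Complex.reCLM.integral_comp_comm i
    simp only [Complex.reCLM_apply, hre, hz, Complex.zero_re] at this
    exact hpos.ne' this
  · by_cases hq : q ∈ Metric.closedBall p r
    · exact mul_nonneg (le_of_lt (hrU hq).2) (mul_nonneg b₁.nonneg b₂.nonneg)
    · have : b₁ q.1 * b₂ q.2 = 0 := by
        by_contra hb
        refine hq (hsub ⟨subset_tsupport _ ?_, subset_tsupport _ ?_⟩)
        · simpa using left_ne_zero_of_mul hb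
        · simpa using right_ne_zero_of_mul hb
      simp [this]
  · have h1 : b₁ p.1 = 1 := b₁.one_of_mem_closedBall (Metric.mem_closedBall_self b₁.rIn_pos.le)
    have h2 : b₂ p.2 = 1 := b₂.one_of_mem_closedBall (Metric.mem_closedBall_self b₂.rIn_pos.le)
    simp only [h1, h2, mul_one]
    exact hφp.ne'

/-! ### The regularized energy-momentum tensor -/

/-- The kernel of the normally ordered product of outgoing fields in the state `Ω_g`. -/
noncomputable def normalKernel (x x₁ x₂ x₃ : ℝ → ℝ) (g : ℝ → ℂ) (y z : ℝ) : ℂ :=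
  ((-(1 / (4 * Real.pi)) * schwarzianKernel x₁ x₂ x₃ y z : ℝ) : ℂ) + particleKernel x x₁ g y z

/-- The outgoing energy-momentum tensor: the Schwarzian derivative of the change of coordinates
and the classical contribution of the wave packet. -/
noncomputable def outgoingEMT (x x₁ x₂ x₃ : ℝ → ℝ) (g : ℝ → ℂ) (y : ℝ) : ℝ :=
  -(1 / (4 * Real.pi)) * (x₃ y / (6 * x₁ y) - (x₂ y / x₁ y) ^ 2 / 4) +
    x₁ y ^ 2 * ‖g (x y)‖ ^ 2 / 2

theorem normalKernel_self {x x₁ x₂ x₃ : ℝ → ℝ} (hx : RegularCoord x x₁ x₂ x₃) (g : 𝓢(ℝ, ℂ))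
    (y : ℝ) :
    normalKernel x x₁ x₂ x₃ g y y = outgoingEMT x x₁ x₂ x₃ g y := by
  rw [normalKernel, hx.schwarzianKernel_self, particleKernel_self, ← Complex.ofReal_add]
  rfl

theorem continuous_particleKernel {x x₁ : ℝ → ℝ} (hx : Continuous x) (hx₁ : Continuous x₁)
    {g : ℝ → ℂ} (hg : Continuous g) :
    Continuous fun p : ℝ × ℝ => particleKernel x x₁ g p.1 p.2 := by
  have := Complex.continuous_conj
  unfold particleKernel
  fun_prop

theorem continuous_normalKernel {x x₁ x₂ x₃ : ℝ → ℝ} (hx : RegularCoord x x₁ x₂ x₃) (g : 𝓢(ℝ, ℂ)) :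
    Continuous fun p : ℝ × ℝ => normalKernel x x₁ x₂ x₃ g p.1 p.2 := by
  have h1 := hx.continuous_schwarzianKernel
  have h2 := continuous_particleKernel hx.continuous hx.continuous_deriv g.continuous
  unfold normalKernel
  fun_prop

/-- The constant `c` stays free to serve both schemes: it is the outgoing vacuum value for the
normal ordered product and `0` for the plain correlation. -/
theorem fockInner_oneParticle_sub {x x₁ x₂ x₃ : ℝ → ℝ} (hx : RegularCoord x x₁ x₂ x₃) (g : 𝓢(ℝ, ℂ))
    (hg : ∀ k : ℝ, k < 0 → incomingMomentum id g k = 0)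
    (hnorm : ∫ k, ‖incomingMomentum id g k‖ ^ 2 ∂momentumMeasure = 1)
    (c : ℂ) {f₁ f₂ : ℝ → ℂ} (hf₁ : IsTestFunction f₁)
    (hf₂ : IsTestFunction f₂) :
    fockInner (oneParticle g) (fieldDeriv x f₁ (fieldDeriv x f₂ (oneParticle g)) -
        c • oneParticle g) =
      vacuumCorrelation x f₁ f₂ - c +
        ∫ p : ℝ × ℝ, particleKernel x x₁ g p.1 p.2 * (f₁ p.1 * f₂ p.2) := by
  have hγ := continuous_incomingMomentum continuous_id g.integrable
  have hγ' : Continuous fun k => conj (incomingMomentum id g k) := Complex.continuous_conj.comp hγ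
  have hb (k : ℝ) := norm_incomingMomentum_le id g k
  have hb' (k : ℝ) : ‖conj (incomingMomentum id g k)‖ ≤ _ := (RCLike.norm_conj _).trans_le (hb k)
  have hn (k : ℝ) : conj (conj (incomingMomentum id g k)) * conj (incomingMomentum id g k) =
      ((‖incomingMomentum id g k‖ ^ 2 : ℝ) : ℂ) := by
    rw [Complex.conj_conj, Complex.mul_conj', Complex.ofReal_pow]
  rw [oneParticle_eq_singleParticle, fockInner_singleParticle_sub x f₁ f₂ _ c
    (integrable_derivModes_mul_derivModes_neg hx hf₁ hf₂)
    (integrable_derivModes_mul hx hf₁ hγ' hb') (by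
      simp_rw [Complex.conj_conj]; exact integrable_mul_derivModes_neg hx hf₁ hγ hb) (by
      simp_rw [Complex.conj_conj]; exact integrable_mul_derivModes_neg hx hf₂ hγ hb) (by
      simp_rw [hn]; exact (integrable_of_integral_eq_one hnorm).ofReal) (by
      simp_rw [hn]; rw [integral_complex_ofReal, hnorm, Complex.ofReal_one]),
    particleCorrelation_eq hx g hg hf₁ hf₂]

theorem isKernelOn_normal {x x₁ x₂ x₃ : ℝ → ℝ} (hx : RegularCoord x x₁ x₂ x₃) (g : 𝓢(ℝ, ℂ))
    (hg : ∀ k : ℝ, k < 0 → incomingMomentum id g k = 0)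
    (hnorm : ∫ k, ‖incomingMomentum id g k‖ ^ 2 ∂momentumMeasure = 1) :
    IsKernelOn (fun f₁ f₂ => fockInner (oneParticle g) (outNormalOrdered x f₁ f₂ (oneParticle g)))
      Set.univ (normalKernel x x₁ x₂ x₃ g) := by
  refine ⟨(continuous_normalKernel hx g).continuousOn, fun f₁ f₂ c₁ s₁ c₂ s₂ _ => ?_⟩
  have hf₁ : IsTestFunction f₁ := ⟨c₁, s₁⟩
  have hf₂ : IsTestFunction f₂ := ⟨c₂, s₂⟩
  have hS : Continuous fun p : ℝ × ℝ =>
      ((-(1 / (4 * Real.pi)) * schwarzianKernel x₁ x₂ x₃ p.1 p.2 : ℝ) : ℂ) := by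
    have := hx.continuous_schwarzianKernel
    fun_prop
  have hP := continuous_particleKernel hx.continuous hx.continuous_deriv g.continuous
  simp only [outNormalOrdered]
  rw [fockInner_oneParticle_sub hx g hg hnorm _ hf₁ hf₂, derivCorrelation_fockVacuum,
    vacuumCorrelation_sub_id hx hf₁ hf₂, ← integral_add (hf₁.integrable_mul_prod hf₂ hS)
      (hf₁.integrable_mul_prod hf₂ hP)]
  congr 1
  funext p
  rw [normalKernel]
  ring

/-- Off the diagonal the subtracted outgoing vacuum value itself has a kernel, which is added back
to the normal ordered one. -/
theorem isKernelOn_derivCorrelation {x x₁ x₂ x₃ : ℝ → ℝ} (hx : RegularCoord x x₁ x₂ x₃) (g : 𝓢(ℝ, ℂ))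
    (hg : ∀ k : ℝ, k < 0 → incomingMomentum id g k = 0)
    (hnorm : ∫ k, ‖incomingMomentum id g k‖ ^ 2 ∂momentumMeasure = 1) :
    IsKernelOn (derivCorrelation x (oneParticle g)) {p | p.1 ≠ p.2}
      (fun y z => normalKernel x x₁ x₂ x₃ g y z + vacuumKernel y z) := by
  refine ⟨(continuous_normalKernel hx g).continuousOn.add continuousOn_vacuumKernel,
    fun f₁ f₂ c₁ s₁ c₂ s₂ hs => ?_⟩
  have hf₁ : IsTestFunction f₁ := ⟨c₁, s₁⟩
  have hf₂ : IsTestFunction f₂ := ⟨c₂, s₂⟩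
  have h := (isKernelOn_normal hx g hg hnorm).2 f₁ f₂ c₁ s₁ c₂ s₂ (Set.subset_univ _)
  have h0 := fockInner_oneParticle_sub hx g hg hnorm 0 hf₁ hf₂
  simp only [outNormalOrdered] at h
  rw [fockInner_oneParticle_sub hx g hg hnorm _ hf₁ hf₂, derivCorrelation_fockVacuum,
    vacuumCorrelation_id hf₁ hf₂ hs] at h
  rw [zero_smul, sub_zero, sub_zero] at h0
  simp_rw [mul_assoc] at h ⊢
  simp_rw [add_mul]
  rw [integral_add (hf₁.integrable_mul_prod hf₂ (continuous_normalKernel hx g))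
    (hf₁.integrable_mul_prod_of_continuousOn hf₂ isOpen_fst_ne_snd continuousOn_vacuumKernel hs),
    ← h, derivCorrelation, h0]
  ring

theorem isKernelOn_derivCorrelation_fockVacuum :
    IsKernelOn (derivCorrelation id fockVacuum) {p | p.1 ≠ p.2} vacuumKernel := by
  refine ⟨continuousOn_vacuumKernel, fun f₁ f₂ c₁ s₁ c₂ s₂ hs => ?_⟩
  rw [derivCorrelation_fockVacuum, vacuumCorrelation_id ⟨c₁, s₁⟩ ⟨c₂, s₂⟩ hs]
  simp_rw [mul_assoc]

/-- `vacuumKernel` depends only on the difference of its arguments, so its point-split values at `y`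
and at `x y` are the same function of `ε` and cancel exactly. Continuity of `normalKernel` does the
rest. -/
theorem tendsto_pointSplit_sub {x x₁ x₂ x₃ : ℝ → ℝ} (hx : RegularCoord x x₁ x₂ x₃) (g : 𝓢(ℝ, ℂ))
    (y : ℝ) : Tendsto (fun ε => pointSplit (fun y z => normalKernel x x₁ x₂ x₃ g y z +
        vacuumKernel y z) y ε - pointSplit vacuumKernel (x y) ε) (𝓝[≠] 0)
      (𝓝 (outgoingEMT x x₁ x₂ x₃ g y : ℂ)) := by
  have hc := continuous_normalKernel hx g
  have h : Tendsto (fun ε => pointSplit (normalKernel x x₁ x₂ x₃ g) y ε) (𝓝 0)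
      (𝓝 (pointSplit (normalKernel x x₁ x₂ x₃ g) y 0)) := by
    refine Continuous.tendsto ?_ 0
    exact ((hc.comp (f := fun ε => (y, y + ε)) (by fun_prop)).add
      (hc.comp (f := fun ε => (y + ε, y)) (by fun_prop))).div_const 2
  have h0 : pointSplit (normalKernel x x₁ x₂ x₃ g) y 0 = outgoingEMT x x₁ x₂ x₃ g y := by
    rw [pointSplit, add_zero, normalKernel_self hx]
    ring
  rw [h0] at h
  refine (h.mono_left nhdsWithin_le_nhds).congr fun ε => ?_
  simp only [pointSplit, vacuumKernel]
  push_cast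
  ring

theorem isOutgoingEMT_iff {x x₁ x₂ x₃ : ℝ → ℝ} (hx : RegularCoord x x₁ x₂ x₃) (g : 𝓢(ℝ, ℂ))
    (hg : ∀ k : ℝ, k < 0 → incomingMomentum id g k = 0)
    (hnorm : ∫ k, ‖incomingMomentum id g k‖ ^ 2 ∂momentumMeasure = 1)
    (s : RegularizationScheme) (y t : ℝ) :
    IsOutgoingEMT x g y t s ↔ t = outgoingEMT x x₁ x₂ x₃ g y := by
  cases s with
  | normal =>
    constructor
    · rintro ⟨K, hK, hKy⟩
      have := hK.unique isOpen_univ (isKernelOn_normal hx g hg hnorm) (Set.mem_univ (y, y))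
      rw [normalKernel_self hx, hKy] at this
      exact_mod_cast this
    · rintro rfl
      exact ⟨_, isKernelOn_normal hx g hg hnorm, normalKernel_self hx g y⟩
  | subtraction =>
    constructor
    · rintro ⟨K, K₀, hK, hK₀, hlim⟩
      refine Complex.ofReal_injective (tendsto_nhds_unique hlim
        ((tendsto_pointSplit_sub hx g y).congr' ?_))
      -- The given kernels are determined only off the diagonal, which is all that the punctured
      -- neighbourhood sees.
      filter_upwards [self_mem_nhdsWithin] with ε hε
      have hε : ε ≠ 0 := hε
      have hK' (p : ℝ × ℝ) (hp : p.1 ≠ p.2) :=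
        (isKernelOn_derivCorrelation hx g hg hnorm).unique isOpen_fst_ne_snd hK hp
      have hK₀' (p : ℝ × ℝ) (hp : p.1 ≠ p.2) :=
        isKernelOn_derivCorrelation_fockVacuum.unique isOpen_fst_ne_snd hK₀ hp
      rw [pointSplit, pointSplit, pointSplit, pointSplit, hK' (y, y + ε) (by simpa using hε),
        hK' (y + ε, y) (by simpa using hε), hK₀' (x y, x y + ε) (by simpa using hε),
        hK₀' (x y + ε, x y) (by simpa using hε)]
    · rintro rfl
      exact ⟨_, _, isKernelOn_derivCorrelation hx g hg hnorm,
        isKernelOn_derivCorrelation_fockVacuum, tendsto_pointSplit_sub hx g y⟩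

/-! ### The two black-hole models -/

theorem hasDerivAt_exp_neg (y : ℝ) : HasDerivAt (fun y => Real.exp (-y)) (-Real.exp (-y)) y := by
  simpa using (hasDerivAt_neg y).exp

theorem regularCoord_relativistic : RegularCoord relativisticCoord (fun y => Real.exp (-y))
    (fun y => -Real.exp (-y)) fun y => Real.exp (-y) where
  hasDerivAt y := (hasDerivAt_exp_neg y).fun_neg.congr_deriv (neg_neg _)
  hasDerivAt_deriv := hasDerivAt_exp_neg
  hasDerivAt_deriv2 y := (hasDerivAt_exp_neg y).fun_neg.congr_deriv (neg_neg _)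
  continuous_deriv3 := by fun_prop
  deriv_pos y := Real.exp_pos _

/-- The derivative of the change of coordinates of the CGHS model. -/
noncomputable def cghsFactor (y : ℝ) : ℝ := (1 + Real.exp y)⁻¹

/-- The logistic equation: all further derivatives of the coordinate are polynomials in
`cghsFactor`, so its limits decide both ends. -/
theorem hasDerivAt_cghsFactor (y : ℝ) :
    HasDerivAt cghsFactor (-(cghsFactor y * (1 - cghsFactor y))) y := by
  have h0 : (1 + Real.exp y) ≠ 0 := by positivity
  refine (((Real.hasDerivAt_exp y).const_add 1).fun_inv h0).congr_deriv ?_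
  rw [cghsFactor]
  field_simp
  ring

theorem continuous_cghsFactor : Continuous cghsFactor :=
  continuous_iff_continuousAt.2 fun y => (hasDerivAt_cghsFactor y).continuousAt

theorem regularCoord_cghs : RegularCoord cghsCoord cghsFactor
    (fun y => -(cghsFactor y * (1 - cghsFactor y)))
    fun y => cghsFactor y * (1 - cghsFactor y) * (1 - 2 * cghsFactor y) where
  hasDerivAt y := by
    have h0 : (1 + Real.exp (-y)) ≠ 0 := by positivity
    refine (((hasDerivAt_exp_neg y).const_add 1).log h0).fun_neg.congr_deriv ?_
    rw [cghsFactor, Real.exp_neg]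
    have := Real.exp_pos y
    field_simp
    ring
  hasDerivAt_deriv := hasDerivAt_cghsFactor
  hasDerivAt_deriv2 y := by
    have h := hasDerivAt_cghsFactor y
    refine (h.fun_mul (h.const_sub 1)).fun_neg.congr_deriv ?_
    ring
  continuous_deriv3 := by
    have := continuous_cghsFactor
    fun_prop
  deriv_pos y := by rw [cghsFactor]; positivity

/-! ### Limits of the energy-momentum tensor. -/

theorem thermalEMT_two_pi : thermalEMT (ENNReal.ofReal (2 * Real.pi)) = 1 / (48 * Real.pi) := by
  rw [thermalEMT_ofReal _ (by positivity)]
  field_simp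
  norm_num

theorem tendsto_outgoingEMT_relativistic (g : 𝓢(ℝ, ℂ)) :
    Tendsto (outgoingEMT relativisticCoord (fun y => Real.exp (-y)) (fun y => -Real.exp (-y))
      (fun y => Real.exp (-y)) g) atTop (𝓝 (thermalEMT (ENNReal.ofReal (2 * Real.pi)))) := by
  have hq : Tendsto (fun y : ℝ => Real.exp (-y)) atTop (𝓝 0) := Real.tendsto_exp_neg_atTop_nhds_zero
  have hx : Tendsto relativisticCoord atTop (𝓝 (-0)) := hq.neg
  have hg := ((g.continuous.tendsto (-0)).comp hx).norm
  -- Here `x₂/x₁ = -1` and `x₃/x₁ = 1`, so the Schwarzian part is constant, `-(1/4π)(1/6 - 1/4) =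
  -- 1/(48π)`. Only the particle term varies: `x₁² → 0` while `g(x(y)) → g(0)`.
  have h := (((hq.pow 2).mul (hg.pow 2)).div_const 2).const_add (1 / (48 * Real.pi))
  rw [thermalEMT_two_pi]
  convert h using 1
  · funext y
    have := Real.exp_pos (-y)
    simp only [outgoingEMT, Function.comp]
    congr 1
    field_simp
    norm_num
  · simp

theorem outgoingEMT_cghs (g : ℝ → ℂ) (y : ℝ) :
    outgoingEMT cghsCoord cghsFactor (fun y => -(cghsFactor y * (1 - cghsFactor y)))
      (fun y => cghsFactor y * (1 - cghsFactor y) * (1 - 2 * cghsFactor y)) g y =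
    -(1 / (4 * Real.pi)) * ((1 - cghsFactor y) * (1 - 2 * cghsFactor y) / 6 -
      (1 - cghsFactor y) ^ 2 / 4) + cghsFactor y ^ 2 * ‖g (cghsCoord y)‖ ^ 2 / 2 := by
  have := (regularCoord_cghs.deriv_pos y).ne'
  simp only [outgoingEMT]
  field_simp

theorem tendsto_outgoingEMT_cghs {g : ℝ → ℂ} {l : Filter ℝ} {q r : ℝ}
    (hq : Tendsto cghsFactor l (𝓝 q)) (hg : Tendsto (fun y => ‖g (cghsCoord y)‖) l (𝓝 r)) :
    Tendsto (outgoingEMT cghsCoord cghsFactor (fun y => -(cghsFactor y * (1 - cghsFactor y)))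
      (fun y => cghsFactor y * (1 - cghsFactor y) * (1 - 2 * cghsFactor y)) g) l
      (𝓝 (-(1 / (4 * Real.pi)) * ((1 - q) * (1 - 2 * q) / 6 - (1 - q) ^ 2 / 4) +
        q ^ 2 * r ^ 2 / 2)) := by
  have h1 := hq.const_sub 1
  exact ((((((h1.mul ((hq.const_mul 2).const_sub 1)).div_const 6).sub
    ((h1.pow 2).div_const 4)).const_mul (-(1 / (4 * Real.pi)))).add
    (((hq.pow 2).mul (hg.pow 2)).div_const 2))).congr fun y => (outgoingEMT_cghs g y).symm

theorem tendsto_outgoingEMT_cghs_atTop (g : 𝓢(ℝ, ℂ)) :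
    Tendsto (outgoingEMT cghsCoord cghsFactor (fun y => -(cghsFactor y * (1 - cghsFactor y)))
      (fun y => cghsFactor y * (1 - cghsFactor y) * (1 - 2 * cghsFactor y)) g) atTop
      (𝓝 (thermalEMT (ENNReal.ofReal (2 * Real.pi)))) := by
  have hq : Tendsto cghsFactor atTop (𝓝 0) :=
    (tendsto_atTop_add_const_left _ 1 Real.tendsto_exp_atTop).inv_tendsto_atTop
  have hx : Tendsto cghsCoord atTop (𝓝 (-Real.log (1 + 0))) :=
    ((Real.tendsto_exp_neg_atTop_nhds_zero.const_add 1).log (by norm_num)).neg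
  -- With `q = 0` the Schwarzian bracket is again `1/6 - 1/4`; the limit of `‖g‖` is irrelevant
  -- since it is multiplied by `q²`.
  have h := tendsto_outgoingEMT_cghs hq ((g.continuous.tendsto _).comp hx).norm
  rw [thermalEMT_two_pi]
  convert h using 2
  field_simp
  norm_num

theorem tendsto_outgoingEMT_cghs_atBot (g : 𝓢(ℝ, ℂ)) :
    Tendsto (outgoingEMT cghsCoord cghsFactor (fun y => -(cghsFactor y * (1 - cghsFactor y)))
      (fun y => cghsFactor y * (1 - cghsFactor y) * (1 - 2 * cghsFactor y)) g) atBot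
      (𝓝 (thermalEMT ⊤)) := by
  have hq : Tendsto cghsFactor atBot (𝓝 (1 + 0)⁻¹) :=
    (Real.tendsto_exp_atBot.const_add 1).inv₀ (by norm_num)
  have hx : Tendsto cghsCoord atBot atBot :=
    tendsto_neg_atTop_atBot.comp (Real.tendsto_log_atTop.comp (tendsto_atTop_add_const_left _ 1
      (Real.tendsto_exp_atTop.comp tendsto_neg_atBot_atTop)))
  have hg : Tendsto g atBot (𝓝 0) :=
    (zero_at_infty g).mono_left atBot_le_cocompact
  -- With `q = 1` both Schwarzian terms vanish through their factor `1 - q`. The particle term no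
  -- longer has a small prefactor; it vanishes because the packet decays as `x(y) → -∞`.
  have h := tendsto_outgoingEMT_cghs hq (hg.comp hx).norm
  rw [thermalEMT_top]
  convert h using 2
  simp

theorem mainTheorem2 (g : 𝓢(ℝ, ℂ))
    (hg : ∀ k : ℝ, k < 0 → incomingMomentum id g k = 0)
    (hnorm : ∫ k, ‖incomingMomentum id g k‖ ^ 2 ∂momentumMeasure = 1)
    (s : RegularizationScheme) :
    (∃ T : ℝ → ℝ,
      (∀ y t : ℝ, IsOutgoingEMT relativisticCoord g y t s ↔ t = T y) ∧
      Tendsto T atTop (𝓝 (thermalEMT (ENNReal.ofReal (2 * Real.pi))))) ∧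
    (∃ T : ℝ → ℝ,
      (∀ y t : ℝ, IsOutgoingEMT cghsCoord g y t s ↔ t = T y) ∧
      Tendsto T atTop (𝓝 (thermalEMT (ENNReal.ofReal (2 * Real.pi)))) ∧
      Tendsto T atBot (𝓝 (thermalEMT ⊤))) :=
  ⟨⟨_, isOutgoingEMT_iff regularCoord_relativistic g hg hnorm s,
    tendsto_outgoingEMT_relativistic g⟩,
    ⟨_, isOutgoingEMT_iff regularCoord_cghs g hg hnorm s,
    tendsto_outgoingEMT_cghs_atTop g, tendsto_outgoingEMT_cghs_atBot g⟩⟩
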